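/- Let $K$ be a field and let $S=\bigoplus_{n\ge 0}S_n$ be a standard graded $K$-algebra, that is, $S$ is a commutative finitely generated $K$-algebra with $S_0=K$ and $S=K[S_1]$. Let $M=\bigoplus_{n\ge 0}M_n$ be a finitely generated graded $S$-module of Krull dimension $m\ge 1$. Then every $M_n$ is finite dimensional over $K$; let $H(M,n)=\dim_K M_n$. Moreover, the following objects exist. (a) A (unique) polynomial $h_M\in\mathbb Z[t]$ with $\sum_{n\ge 0}H(M,n)t^n=\dfrac{h_M(t)}{(1-t)^m}$ and $h_M(1)\neq 0$; the multiplicity of $M$ is $e(M):=h_M(1)$. (b) A (unique) polynomial $P_M(t)=d_{M,m-1}t^{m-1}+\cdots+d_{M,0}\in\mathbb Q[t]$, of degree $m-1$, with $P_M(n)=H(M,n)$ for all $n\gg 0$; and (unique) rational numbers $e_0(M),\ldots,e_{m-1}(M)$ with $P_M(t)=\sum_{k=0}^{m-1}(-1)^k e_k(M)\binom{t+m-1-k}{m-1-k}$. (c) For every real $w>0$, a meromorphic function $z\mapsto\zeta_M(z,w)$ on $\mathbb C$ which for $\operatorname{Re} z>m$ is the sum of the convergent series $\sum_{n\ge 0}H(M,n)(n+w)^{-z}$;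 and a meromorphic function $\zeta_M$ on $\mathbb C$ which for $\operatorname{Re}z>m$ satisfies $$\zeta_M(z)=\lim_{w\searrow 0}\bigl(\zeta_M(z,w)-H(M,0)w^{-z}\bigr)=\sum_{n\ge 1}\frac{H(M,n)}{n^{z}}.$$ With these notations, $$e(M)=e_0(M)=(m-1)!\,d_{M,m-1}=(m-1)!\operatorname{Res}_{z=m}\zeta_M(z),$$ $$\operatorname{Res}_{z=m}\zeta_M(z)=\lim_{w\searrow 0}\operatorname{Res}_{z=m}\zeta_M(z,w),\qquad\text{and hence}\qquad e(M)=(m-1)!\lim_{w\searrow 0}\operatorname{Res}_{z=m}\zeta_M(z,w).$$ -/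

import Mathlib

open Filter Topology

noncomputable section

namespace GradedZeta

section Algebra

variable {K S M : Type*} [Field K] [CommRing S] [Algebra K S] [AddCommGroup M] [Module K M]

/-- The `ℕ`-graded `K`-algebra `S = ⨁ n, 𝒜 n` is a standard graded `K`-algebra:
`S₀ = K`, `S` is a finitely generated `K`-algebra, and `S = K[S₁]`. -/
structure IsStandardGraded (𝒜 : ℕ → Submodule K S) : Prop where
  injective_algebraMap : Function.Injective (algebraMap K S)
  degree_zero : 𝒜 0 = LinearMap.range (Algebra.linearMap K S)
  finiteType : Algebra.FiniteType K S
  adjoin_degree_one : Algebra.adjoin K (𝒜 1 : Set S) = ⊤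

/-- The Hilbert function `H(M, n) = dim_K M_n`. -/
def hilbertFunction (ℳ : ℕ → Submodule K M) (n : ℕ) : ℕ :=
  Module.finrank K (ℳ n)

/-- The Hilbert series `H_M(t) = ∑ H(M, n) t ^ n`. -/
def hilbertSeries (ℳ : ℕ → Submodule K M) : PowerSeries ℤ :=
  PowerSeries.mk fun n => (hilbertFunction ℳ n : ℤ)

/-- `h` is the numerator `h_M` of the Hilbert series: `H_M(t) = h(t) / (1 - t) ^ m`
and `h(1) ≠ 0`. -/
def IsHilbertNumerator (ℳ : ℕ → Submodule K M) (m : ℕ) (h : Polynomial ℤ) : Prop :=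
  (1 - PowerSeries.X) ^ m * hilbertSeries ℳ = (h : PowerSeries ℤ) ∧ h.eval 1 ≠ 0

open Classical in
/-- The numerator `h_M` of the Hilbert series (unique if it exists; `0` otherwise). -/
def hilbertNumerator (ℳ : ℕ → Submodule K M) (m : ℕ) : Polynomial ℤ :=
  if h : ∃ p, IsHilbertNumerator ℳ m p then h.choose else 0

/-- The multiplicity `e(M) = h_M(1)`, for `M` of dimension `m`. -/
def multiplicity (ℳ : ℕ → Submodule K M) (m : ℕ) : ℤ :=
  (hilbertNumerator ℳ m).eval 1

/-- `P(n) = H(M, n)` for all large `n`. -/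
def IsHilbertPolynomial (ℳ : ℕ → Submodule K M) (P : Polynomial ℚ) : Prop :=
  ∀ᶠ n : ℕ in atTop, P.eval (n : ℚ) = (hilbertFunction ℳ n : ℚ)

open Classical in
/-- The Hilbert polynomial `P_M` (unique if it exists; `0` otherwise). -/
def hilbertPolynomial (ℳ : ℕ → Submodule K M) : Polynomial ℚ :=
  if h : ∃ P, IsHilbertPolynomial ℳ P then h.choose else 0

/-- `e 0, …, e (m - 1)` are the coefficients of the Hilbert polynomial in
`P_M(t) = ∑_{k < m} (-1) ^ k e_k binom (t + m - 1 - k) (m - 1 - k)`; the sequence is extended by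
zero. Here `Polynomial.preHilbertPoly ℚ j 0` is the polynomial `binom (t + j) j`. -/
def IsHilbertCoeffs (ℳ : ℕ → Submodule K M) (m : ℕ) (e : ℕ → ℚ) : Prop :=
  hilbertPolynomial ℳ =
      ∑ k ∈ Finset.range m, ((-1) ^ k * e k) • Polynomial.preHilbertPoly ℚ (m - 1 - k) 0 ∧
    ∀ k, m ≤ k → e k = 0

open Classical in
/-- The coefficients `e_k(M)` (unique if they exist; `0` otherwise). -/
def hilbertCoeff (ℳ : ℕ → Submodule K M) (m : ℕ) : ℕ → ℚ :=
  if h : ∃ e, IsHilbertCoeffs ℳ m e then h.choose else 0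

end Algebra

section Analysis

/-- `F` is a meromorphic function on `ℂ` which is the sum of the series `∑ n, u n z`, convergent
for `Re z > σ`. The normal form fixes the values of `F` at the isolated points where a meromorphic
function is otherwise undetermined (in particular `F = 0` at the poles), so that `F` is unique. -/
structure IsMeromorphicContinuation (u : ℕ → ℂ → ℂ) (σ : ℝ) (F : ℂ → ℂ) : Prop where
  meromorphic : MeromorphicNFOn F Set.univ
  hasSum : ∀ z : ℂ, σ < z.re → HasSum (fun n => u n z) (F z)

open Classical in
/-- The meromorphic continuation to `ℂ` of the series `∑ n, u n z`, convergent for `Re z > σ`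
(unique if it exists; `0` otherwise). -/
def meromorphicContinuation (u : ℕ → ℂ → ℂ) (σ : ℝ) : ℂ → ℂ :=
  if h : ∃ F, IsMeromorphicContinuation u σ F then h.choose else 0

/-- The residue at `c` of a function which is holomorphic in a punctured neighbourhood of `c`:
the common value of `(1 / 2πi) ∮ f` over all small circles around `c`. -/
def residue (f : ℂ → ℂ) (c : ℂ) : ℂ :=
  limUnder (𝓝[>] (0 : ℝ)) fun r => (2 * Real.pi * Complex.I)⁻¹ * ∮ z in C(c, r), f z

variable {K M : Type*} [Field K] [AddCommGroup M] [Module K M]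

/-- The terms `H(M, n) / (n + w) ^ z`, `n ≥ 0`, of the series `ζ_M(z, w)`. -/
def zetaBarnesTerm (ℳ : ℕ → Submodule K M) (w : ℝ) (n : ℕ) (z : ℂ) : ℂ :=
  (hilbertFunction ℳ n : ℂ) / ((n : ℂ) + (w : ℂ)) ^ z

/-- The terms `H(M, n) / n ^ z`, `n ≥ 1`, of the series `ζ_M(z)` (the index is shifted by one). -/
def zetaTerm (ℳ : ℕ → Submodule K M) (n : ℕ) (z : ℂ) : ℂ :=
  (hilbertFunction ℳ (n + 1) : ℂ) / ((n + 1 : ℕ) : ℂ) ^ z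

/-- The Zeta-Barnes type function `z ↦ ζ_M(z, w)`, as a meromorphic function on `ℂ`, for `M` of
dimension `m` and `w > 0`. -/
def zetaBarnes (ℳ : ℕ → Submodule K M) (m : ℕ) (w : ℝ) : ℂ → ℂ :=
  meromorphicContinuation (zetaBarnesTerm ℳ w) m

/-- The function `z ↦ ζ_M(z)`, as a meromorphic function on `ℂ`, for `M` of dimension `m`. -/
def zeta (ℳ : ℕ → Submodule K M) (m : ℕ) : ℂ → ℂ :=
  meromorphicContinuation (zetaTerm ℳ) m

end Analysis

end GradedZeta

end

noncomputable section

namespace GradedZeta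

/-! ### Krull dimension under integral extensions and Noether normalization of a module -/

section Dimension

/-! The algebraic half has two independent inputs. By Hilbert-Serre (`exists_polynomial_of_stable`),
the Hilbert series is a polynomial over a power of `1 - t`; after cancellation it is `h / (1 - t) ^
d` with `h(1) ≠ 0`, for some `d` not yet known. The Krull dimension enters only through growth.
Noether normalization of `S / Ann M` makes `M` finite and faithful over a polynomial ring in `m`
variables. This map need not be homogeneous, so graded pieces are compared with images of the
polynomials whose partial degrees are at most `n`, a space of dimension `(n + 1) ^ m`. Up to linear
rescaling of `n`, this bounds `∑_{k ≤ n} H(M, k)` above and below by multiples of `n ^ m`. These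
sums are eventually a polynomial of degree `d`, so `d = m` (`exists_numerator`). The coefficient of
`t ^ (m - 1)` in the Hilbert polynomial is then `h(1) / (m - 1)!`.

For the analytic half, rewrite the Hilbert polynomial in powers of `n + w`. Up to finitely many
entire terms, `ζ_M(z, w)` becomes a combination of Hurwitz zeta functions `ζ(z - j, w)` with `j < m`
(`exists_continuation`). Only `j = m - 1` can give a pole at `z = m`, and its coefficient is
unchanged by the translation. The residue is therefore `d_{M,m-1}` for every `w`, and the limit of
residues is the limit of a constant. The same argument with parameter `1` and the sequence `H(M, n +
1)` treats `ζ_M(z)`. -/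

theorem ringKrullDim_le_of_isIntegral {R A : Type*} [CommRing R] [CommRing A] [Algebra R A]
    [Algebra.IsIntegral R A] : ringKrullDim A ≤ ringKrullDim R :=
  Order.krullDim_le_of_strictMono (PrimeSpectrum.comap (algebraMap R A)) fun p q h => by
    have := p.2
    exact Ideal.IsIntegral.comap_lt_comap (R := R) (I := p.asIdeal) (J := q.asIdeal) h

/-- Lying over starts the chain and going up extends it. Remembering the prime below the last term
is what lets the induction continue. -/
theorem exists_ltSeries_over {R A : Type*} [CommRing R] [CommRing A] [Algebra R A]
    [Algebra.IsIntegral R A] (hinj : Function.Injective (algebraMap R A))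
    (l : LTSeries (PrimeSpectrum R)) :
    ∃ l' : LTSeries (PrimeSpectrum A), l'.length = l.length ∧
      PrimeSpectrum.comap (algebraMap R A) l'.last = l.last := by
  induction l using RelSeries.inductionOn' with
  | singleton x =>
    obtain ⟨Q, -, hQ, hQ'⟩ := Ideal.exists_ideal_over_prime_of_isIntegral x.asIdeal (⊥ : Ideal A)
      (by
        intro y hy
        have : algebraMap R A y = 0 := hy
        rw [(map_eq_zero_iff _ hinj).mp this]
        exact zero_mem _)
    refine ⟨RelSeries.singleton _ ⟨Q, hQ⟩, rfl, ?_⟩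
    simp only [RelSeries.last_singleton]
    exact PrimeSpectrum.ext hQ'
  | snoc p x hx ih =>
    obtain ⟨l', hl, hlast⟩ := ih
    have hle : Ideal.comap (algebraMap R A) l'.last.asIdeal ≤ x.asIdeal := by
      have h1 : p.last < x := hx
      rw [← hlast] at h1
      exact h1.le
    obtain ⟨Q, hQl, hQ, hQ'⟩ :=
      Ideal.exists_ideal_over_prime_of_isIntegral x.asIdeal l'.last.asIdeal hle
    have hlt : l'.last < (⟨Q, hQ⟩ : PrimeSpectrum A) := by
      refine lt_of_le_of_ne hQl ?_
      rintro h
      have h1 : p.last < x := hx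
      rw [← hlast, h] at h1
      exact h1.ne (PrimeSpectrum.ext hQ')
    refine ⟨l'.snoc ⟨Q, hQ⟩ hlt, by simp [hl], ?_⟩
    simp only [RelSeries.last_snoc]
    exact PrimeSpectrum.ext hQ'

theorem ringKrullDim_eq_of_isIntegral_of_injective {R A : Type*} [CommRing R] [CommRing A]
    [Algebra R A] [Algebra.IsIntegral R A] (hinj : Function.Injective (algebraMap R A)) :
    ringKrullDim A = ringKrullDim R := by
  refine le_antisymm ringKrullDim_le_of_isIntegral ?_
  refine iSup_le fun l => ?_
  obtain ⟨l', hl, -⟩ := exists_ltSeries_over (A := A) hinj l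
  rw [← hl]
  exact le_iSup (fun p : LTSeries (PrimeSpectrum A) => ((p.length : ℕ) : WithBot ℕ∞)) l'

/-- Noether normalization of a finite module: a polynomial ring in `dim M` variables acts
faithfully on `M`, and `M` is finite over it. -/
theorem exists_finite_faithful_mvPolynomial {K S M : Type*} [Field K] [CommRing S] [Algebra K S]
    [Algebra.FiniteType K S] [AddCommGroup M] [Module S M] [Module.Finite S M]
    (m : ℕ) (hdim : Module.supportDim S M = (m : WithBot ℕ∞)) :
    ∃ φ : MvPolynomial (Fin m) K →ₐ[K] S, (∀ b, (∀ x : M, φ b • x = 0) → b = 0) ∧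
      ∃ (r : ℕ) (a : Fin r → M), ∀ x, ∃ b : Fin r → MvPolynomial (Fin m) K,
        x = ∑ j, φ (b j) • a j := by
  set I := Module.annihilator S M with hI
  have hd : ringKrullDim (S ⧸ I) = m := by
    rw [← hdim, Module.supportDim_eq_ringKrullDim_quotient_annihilator]
  have hnt : Nontrivial (S ⧸ I) := by
    by_contra h
    rw [not_nontrivial_iff_subsingleton] at h
    rw [ringKrullDim_eq_bot_of_subsingleton] at hd
    exact absurd hd (by simp)
  obtain ⟨s, g, hg, hfin⟩ := exists_finite_inj_algHom_of_fg K (S ⧸ I)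
  have hs : s = m := by
    let _ : Algebra (MvPolynomial (Fin s) K) (S ⧸ I) := g.toRingHom.toAlgebra
    have : Module.Finite (MvPolynomial (Fin s) K) (S ⧸ I) := hfin
    have h1 := ringKrullDim_eq_of_isIntegral_of_injective
      (R := MvPolynomial (Fin s) K) (A := S ⧸ I) hg
    rw [hd, MvPolynomial.ringKrullDim_of_isNoetherianRing, ringKrullDim_eq_zero_of_field] at h1
    simp only [Nat.card_eq_fintype_card, Fintype.card_fin, zero_add] at h1
    exact_mod_cast h1.symm
  subst hs
  -- Normalization lands in `S / Ann M`; lifting the images of the variables gives a map into `S`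
  -- with the same action on `M`.
  choose y hy using fun i => Ideal.Quotient.mk_surjective (I := I) (g (MvPolynomial.X i))
  set φ : MvPolynomial (Fin s) K →ₐ[K] S := MvPolynomial.aeval y with hφ
  have hcomp : ∀ b, Ideal.Quotient.mk I (φ b) = g b := by
    intro b
    have : (Ideal.Quotient.mkₐ K I).comp φ = g := by
      ext i
      simp [hφ, hy]
    exact DFunLike.congr_fun this b
  refine ⟨φ, ?_, ?_⟩
  · intro b hb
    have h1 : φ b ∈ I := Module.mem_annihilator.mpr hb
    rw [← Ideal.Quotient.eq_zero_iff_mem, hcomp] at h1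
    exact (map_eq_zero_iff g hg).mp h1
  · let _ : Module (MvPolynomial (Fin s) K) M := Module.compHom M φ.toRingHom
    have hsm : ∀ (b : MvPolynomial (Fin s) K) (x : M), b • x = φ b • x := fun b x => rfl
    have : Module.Finite (MvPolynomial (Fin s) K) M := by
      let _ : Module (S ⧸ I) M := (Module.isTorsionBySet_annihilator S M).module
      have : IsScalarTower S (S ⧸ I) M := (Module.isTorsionBySet_annihilator S M).isScalarTower
      let _ : Algebra (MvPolynomial (Fin s) K) (S ⧸ I) := g.toRingHom.toAlgebra
      have : Module.Finite (MvPolynomial (Fin s) K) (S ⧸ I) := hfin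
      have : Module.Finite (S ⧸ I) M := Module.Finite.of_restrictScalars_finite S _ _
      have : IsScalarTower (MvPolynomial (Fin s) K) (S ⧸ I) M := by
        refine ⟨fun b q x => ?_⟩
        rw [Algebra.smul_def, mul_smul, hsm]
        change g b • _ = _
        rw [← hcomp]
        rfl
      exact Module.Finite.trans (S ⧸ I) M
    obtain ⟨r, a, ha⟩ := Module.Finite.exists_fin (R := MvPolynomial (Fin s) K) (M := M)
    refine ⟨r, a, fun x => ?_⟩
    have hx : x ∈ Submodule.span (MvPolynomial (Fin s) K) (Set.range a) := by
      rw [ha]; trivial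
    rw [Submodule.mem_span_range_iff_exists_fun] at hx
    obtain ⟨b, hb⟩ := hx
    exact ⟨b, hb.symm⟩

end Dimension

/-! ### Graded submodules described by stable families of subspaces -/

section Families

variable {K S M : Type*} [Field K] [CommRing S] [Algebra K S] [AddCommGroup M] [Module K M]
  [Module S M] [IsScalarTower K S M]

/-- A standard graded algebra is generated by finitely many elements of degree one. -/
theorem IsStandardGraded.exists_finset {𝒜 : ℕ → Submodule K S} (h : IsStandardGraded 𝒜) :
    ∃ G : Finset S, (G : Set S) ⊆ 𝒜 1 ∧ Algebra.adjoin K (G : Set S) = ⊤ := by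
  classical
  obtain ⟨T, hT⟩ := h.finiteType
  have key : ∀ s : S, ∃ G : Finset S, (G : Set S) ⊆ 𝒜 1 ∧ s ∈ Algebra.adjoin K (G : Set S) := by
    intro s
    have hs : s ∈ Algebra.adjoin K (𝒜 1 : Set S) := by rw [h.adjoin_degree_one]; trivial
    induction hs using Algebra.adjoin_induction with
    | mem x hx => exact ⟨{x}, by simpa using hx, Algebra.subset_adjoin (by simp)⟩
    | algebraMap r => exact ⟨∅, by simp, Subalgebra.algebraMap_mem _ r⟩
    | add x y _ _ hx hy =>
      obtain ⟨G, hG, hx⟩ := hx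
      obtain ⟨G', hG', hy⟩ := hy
      exact ⟨G ∪ G', by simp [hG, hG'], add_mem (Algebra.adjoin_mono (by simp) hx)
        (Algebra.adjoin_mono (by simp) hy)⟩
    | mul x y _ _ hx hy =>
      obtain ⟨G, hG, hx⟩ := hx
      obtain ⟨G', hG', hy⟩ := hy
      exact ⟨G ∪ G', by simp [hG, hG'], mul_mem (Algebra.adjoin_mono (by simp) hx)
        (Algebra.adjoin_mono (by simp) hy)⟩
  choose G hG hG' using key
  refine ⟨T.biUnion G, ?_, ?_⟩
  · intro x hx
    simp only [Finset.coe_biUnion, Set.mem_iUnion] at hx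
    obtain ⟨t, -, hx⟩ := hx
    exact hG t hx
  · rw [eq_top_iff, ← hT]
    refine Algebra.adjoin_le fun t ht => Algebra.adjoin_mono ?_ (hG' t)
    exact_mod_cast Finset.subset_biUnion_of_mem G ht

variable (ℳ : ℕ → Submodule K M) [DirectSum.Decomposition ℳ]

theorem decompose_smul_succ {g : S} (hg : ∀ n, ∀ x ∈ ℳ n, g • x ∈ ℳ (n + 1)) (x : M) (n : ℕ) :
    (DirectSum.decompose ℳ (g • x) (n + 1) : M) = g • (DirectSum.decompose ℳ x n : M) := by
  induction x using DirectSum.Decomposition.inductionOn ℳ with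
  | zero => simp
  | @homogeneous i y =>
    by_cases h : i = n
    · subst h
      rw [DirectSum.decompose_of_mem_same _ (hg _ _ y.2), DirectSum.decompose_of_mem_same _ y.2]
    · rw [DirectSum.decompose_of_mem_ne _ (hg _ _ y.2) (by omega),
        DirectSum.decompose_of_mem_ne _ y.2 h, smul_zero]
  | add x y hx hy =>
    rw [smul_add, DirectSum.decompose_add, DirectSum.decompose_add, DirectSum.add_apply,
      DirectSum.add_apply, Submodule.coe_add, Submodule.coe_add, hx, hy, smul_add]

theorem decompose_smul_zero {g : S} (hg : ∀ n, ∀ x ∈ ℳ n, g • x ∈ ℳ (n + 1)) (x : M) :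
    (DirectSum.decompose ℳ (g • x) 0 : M) = 0 := by
  induction x using DirectSum.Decomposition.inductionOn ℳ with
  | zero => simp
  | @homogeneous i y => rw [DirectSum.decompose_of_mem_ne _ (hg _ _ y.2) (by omega)]
  | add x y hx hy =>
    rw [smul_add, DirectSum.decompose_add, DirectSum.add_apply, Submodule.coe_add, hx, hy, add_zero]

/-- The `S`-submodule of all elements whose homogeneous components lie in a family of subspaces
which is stable under generators of `S` of degree one. -/
def submoduleOfFamily {G : Set S} (hG : Algebra.adjoin K G = ⊤)
    (hdeg : ∀ g ∈ G, ∀ n, ∀ x ∈ ℳ n, g • x ∈ ℳ (n + 1)) (F : ℕ → Submodule K M)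
    (hF : ∀ g ∈ G, ∀ n, ∀ x ∈ F n, g • x ∈ F (n + 1)) : Submodule S M where
  carrier := {x | ∀ n, (DirectSum.decompose ℳ x n : M) ∈ F n}
  zero_mem' := by simp
  add_mem' := by
    intro x y hx hy n
    rw [DirectSum.decompose_add, DirectSum.add_apply, Submodule.coe_add]
    exact add_mem (hx n) (hy n)
  smul_mem' := by
    intro s
    have hs : s ∈ Algebra.adjoin K G := by rw [hG]; trivial
    induction hs using Algebra.adjoin_induction with
    | mem g hg =>
      rintro x hx (_ | n)
      · rw [decompose_smul_zero ℳ (hdeg g hg)]; exact zero_mem _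
      · rw [decompose_smul_succ ℳ (hdeg g hg)]; exact hF g hg n _ (hx n)
    | algebraMap r =>
      intro x hx n
      rw [algebraMap_smul, DirectSum.decompose_smul, DirectSum.smul_apply, Submodule.coe_smul]
      exact Submodule.smul_mem _ _ (hx n)
    | add a b _ _ ha hb =>
      intro x hx n
      rw [add_smul, DirectSum.decompose_add, DirectSum.add_apply, Submodule.coe_add]
      exact add_mem (ha hx n) (hb hx n)
    | mul a b _ _ ha hb =>
      intro x hx n
      rw [mul_smul]
      exact ha (hb hx) n

theorem mem_submoduleOfFamily {G : Set S} (hG : Algebra.adjoin K G = ⊤)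
    (hdeg : ∀ g ∈ G, ∀ n, ∀ x ∈ ℳ n, g • x ∈ ℳ (n + 1)) (F : ℕ → Submodule K M)
    (hF : ∀ g ∈ G, ∀ n, ∀ x ∈ F n, g • x ∈ F (n + 1)) (x : M) :
    x ∈ submoduleOfFamily ℳ hG hdeg F hF ↔ ∀ n, (DirectSum.decompose ℳ x n : M) ∈ F n := Iff.rfl

theorem mem_submoduleOfFamily_of_mem {G : Set S} (hG : Algebra.adjoin K G = ⊤)
    (hdeg : ∀ g ∈ G, ∀ n, ∀ x ∈ ℳ n, g • x ∈ ℳ (n + 1)) (F : ℕ → Submodule K M)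
    (hF : ∀ g ∈ G, ∀ n, ∀ x ∈ F n, g • x ∈ F (n + 1)) {x : M} {n : ℕ} (hx : x ∈ ℳ n) :
    x ∈ submoduleOfFamily ℳ hG hdeg F hF ↔ x ∈ F n := by
  rw [mem_submoduleOfFamily]
  constructor
  · intro h
    have := h n
    rwa [DirectSum.decompose_of_mem_same _ hx] at this
  · intro h k
    by_cases hk : n = k
    · subst hk
      rwa [DirectSum.decompose_of_mem_same _ hx]
    · rw [DirectSum.decompose_of_mem_ne _ hx hk]
      exact zero_mem _

/-- In a Noetherian module, if the generators of degree one map `L` into `N`, then `L = N` in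
large degrees. -/
theorem eventually_le_of_smul_le [IsNoetherian S M] {G : Set S} (hG : Algebra.adjoin K G = ⊤)
    (hdeg : ∀ g ∈ G, ∀ n, ∀ x ∈ ℳ n, g • x ∈ ℳ (n + 1)) (N L : ℕ → Submodule K M)
    (hL : ∀ n, L n ≤ ℳ n) (hNL : ∀ n, N n ≤ L n)
    (h : ∀ g ∈ G, ∀ n, ∀ x ∈ L n, g • x ∈ N (n + 1)) :
    ∃ n₀, ∀ n, n₀ ≤ n → L n ≤ N n := by
  -- Following `L` below degree `k` and `N` from there on is stable, since generators send `L` into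
  -- `N`. The resulting submodules increase with `k`, so they stabilize, and this forces `L n ≤ N n`
  -- for large `n`.
  let F : ℕ → ℕ → Submodule K M := fun k n => if n < k then L n else N n
  have hFL : ∀ k n, F k n ≤ L n := by
    intro k n
    by_cases hk : n < k <;> simp [F, hk, hNL]
  have hNF : ∀ k n, N n ≤ F k n := by
    intro k n
    by_cases hk : n < k <;> simp [F, hk, hNL]
  have hF : ∀ k, ∀ g ∈ G, ∀ n, ∀ x ∈ F k n, g • x ∈ F k (n + 1) := fun k g hg n x hx =>
    hNF _ _ (h g hg n x (hFL _ _ hx))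
  have hmono : Monotone fun k => submoduleOfFamily ℳ hG hdeg (F k) (hF k) := by
    intro k l hkl x hx n
    have h1 := hx n
    by_cases hn : n < k
    · have hn' : n < l := by omega
      simpa [F, hn, hn'] using h1
    · simp only [F, hn, if_false] at h1
      exact hNF _ _ h1
  obtain ⟨n₀, hn₀⟩ := monotone_stabilizes_iff_noetherian.mpr ‹IsNoetherian S M› ⟨_, hmono⟩
  refine ⟨n₀, fun n hn x hx => ?_⟩
  have h1 : x ∈ submoduleOfFamily ℳ hG hdeg (F (n + 1)) (hF (n + 1)) := by
    rw [mem_submoduleOfFamily_of_mem ℳ hG hdeg _ _ (hL n hx)]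
    simpa [F] using hx
  have h2 := hn₀ (n + 1) (by omega)
  simp only [OrderHom.coe_mk] at h2
  rw [← h2, mem_submoduleOfFamily_of_mem ℳ hG hdeg _ _ (hL n hx)] at h1
  simpa [F, not_lt.mpr hn] using h1

end Families

/-! ### Growth of the Hilbert function compared with a polynomial ring in `m` variables -/

section Growth

open MvPolynomial in
theorem mem_restrictDegree_iff_degreeOf {σ R : Type*} [CommSemiring R] (p : MvPolynomial σ R)
    (n : ℕ) : p ∈ restrictDegree σ R n ↔ ∀ i, degreeOf i p ≤ n := by
  rw [mem_restrictDegree]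
  simp only [degreeOf_le_iff]
  exact ⟨fun h i s hs => h s hs i, fun h s hs i => h i s hs⟩

theorem finrank_restrictDegree (K : Type*) [Field K] (m n : ℕ) :
    Module.finrank K (MvPolynomial.restrictDegree (Fin m) K n) = (n + 1) ^ m := by
  rw [MvPolynomial.restrictDegree,
    Module.finrank_eq_nat_card_basis (MvPolynomial.basisRestrictSupport K _)]
  have e : {f : Fin m →₀ ℕ | ∀ i, f i ≤ n} ≃ (Fin m → Fin (n + 1)) :=
    { toFun := fun f i => ⟨f.1 i, Nat.lt_succ_of_le (f.2 i)⟩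
      invFun := fun f => ⟨Finsupp.equivFunOnFinite.symm fun i => (f i : ℕ), fun i =>
        Nat.le_of_lt_succ (f i).2⟩
      left_inv := fun f => by ext; simp
      right_inv := fun f => by ext; simp }
  rw [Nat.card_congr e]
  simp

variable {K S M : Type*} [Field K] [CommRing S] [Algebra K S] [AddCommGroup M] [Module K M]
  [Module S M] [IsScalarTower K S M]

/-- The linear map `(b_j) ↦ ∑ j, φ (b_j) a_j` on tuples of polynomials with all partial degrees
at most `e`. -/
def boxMap {m r : ℕ} (φ : MvPolynomial (Fin m) K →ₐ[K] S) (a : Fin r → M) (e : ℕ) :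
    (Fin r → MvPolynomial.restrictDegree (Fin m) K e) →ₗ[K] M where
  toFun b := ∑ j, φ (b j : MvPolynomial (Fin m) K) • a j
  map_add' b c := by simp [add_smul, Finset.sum_add_distrib]
  map_smul' k b := by simp [Finset.smul_sum]

/-- The image of `boxMap`. -/
def box {m r : ℕ} (φ : MvPolynomial (Fin m) K →ₐ[K] S) (a : Fin r → M) (e : ℕ) : Submodule K M :=
  LinearMap.range (boxMap φ a e)

section Box

variable {m r : ℕ} (φ : MvPolynomial (Fin m) K →ₐ[K] S) (a : Fin r → M)

theorem mem_box {e : ℕ} {x : M} : x ∈ box φ a e ↔ ∃ b : Fin r → MvPolynomial (Fin m) K,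
    (∀ j, b j ∈ MvPolynomial.restrictDegree (Fin m) K e) ∧ x = ∑ j, φ (b j) • a j := by
  constructor
  · rintro ⟨b, rfl⟩
    exact ⟨fun j => b j, fun j => (b j).2, rfl⟩
  · rintro ⟨b, hb, rfl⟩
    exact ⟨fun j => ⟨b j, hb j⟩, rfl⟩

instance (e : ℕ) : Module.Finite K (box φ a e) := by
  unfold box; infer_instance

theorem finrank_box_le (e : ℕ) : Module.finrank K (box φ a e) ≤ r * (e + 1) ^ m := by
  refine (LinearMap.finrank_range_le _).trans ?_
  rw [Module.finrank_pi_fintype]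
  simp [finrank_restrictDegree]

theorem box_mono {e e' : ℕ} (h : e ≤ e') : box φ a e ≤ box φ a e' := by
  intro x hx
  rw [mem_box] at hx ⊢
  obtain ⟨b, hb, rfl⟩ := hx
  refine ⟨b, fun j => ?_, rfl⟩
  have := hb j
  rw [mem_restrictDegree_iff_degreeOf] at this ⊢
  exact fun i => (this i).trans h

theorem exists_mem_box (h : ∀ x, ∃ b : Fin r → MvPolynomial (Fin m) K, x = ∑ j, φ (b j) • a j)
    (x : M) : ∃ e, x ∈ box φ a e := by
  obtain ⟨b, hb⟩ := h x
  refine ⟨∑ j, ∑ i, MvPolynomial.degreeOf i (b j), (mem_box φ a).mpr ⟨b, fun j => ?_, hb⟩⟩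
  rw [mem_restrictDegree_iff_degreeOf]
  intro i
  refine le_trans ?_ (Finset.single_le_sum
    (f := fun j => ∑ i, MvPolynomial.degreeOf i (b j)) (fun _ _ => Nat.zero_le _)
      (Finset.mem_univ j))
  exact Finset.single_le_sum (f := fun i => MvPolynomial.degreeOf i (b j))
    (fun _ _ => Nat.zero_le _) (Finset.mem_univ i)

/-- On the generators `a j`, the action of `g` is given by a matrix of polynomials with partial
degrees at most `e`, and partial degrees are subadditive under products. -/
theorem smul_mem_box {e : ℕ} {g : S} (hg : ∀ j, g • a j ∈ box φ a e) {n : ℕ} {x : M}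
    (hx : x ∈ box φ a n) : g • x ∈ box φ a (n + e) := by
  obtain ⟨b, hb, rfl⟩ := (mem_box φ a).mp hx
  choose c hc hc' using fun j => (mem_box φ a).mp (hg j)
  refine (mem_box φ a).mpr ⟨fun k => ∑ j, b j * c j k, fun k => ?_, ?_⟩
  · refine Submodule.sum_mem _ fun j _ => ?_
    have h1 := hb j
    have h2 := hc j k
    rw [mem_restrictDegree_iff_degreeOf] at h1 h2 ⊢
    exact fun i => (MvPolynomial.degreeOf_mul_le i _ _).trans (add_le_add (h1 i) (h2 i))
  · rw [Finset.smul_sum]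
    simp_rw [smul_comm g, hc', Finset.smul_sum, map_sum, Finset.sum_smul, map_mul, mul_smul]
    rw [Finset.sum_comm]

variable (ℳ : ℕ → Submodule K M) [DirectSum.Decomposition ℳ]

/-- Degree `n` is reached from homogeneous components of the `a j` by at most `n` multiplications by
elements of `G`, each enlarging the box by a fixed amount. -/
theorem exists_le_box (h : ∀ x, ∃ b : Fin r → MvPolynomial (Fin m) K, x = ∑ j, φ (b j) • a j)
    {G : Finset S} (hG : Algebra.adjoin K (G : Set S) = ⊤)
    (hdeg : ∀ g ∈ (G : Set S), ∀ n, ∀ x ∈ ℳ n, g • x ∈ ℳ (n + 1)) :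
    ∃ e, ∀ n, ∀ k ≤ n, ℳ k ≤ box φ a (e * (n + 1)) := by
  classical
  choose E hE using exists_mem_box φ a h
  -- `e₁` bounds the cost of one multiplication by a generator, `e₂` the boxes containing the
  -- homogeneous components of the `a j`.
  let e₁ := ∑ g ∈ G, ∑ j, E (g • a j)
  let e₂ := ∑ j, ∑ n ∈ (DirectSum.decompose ℳ (a j)).support,
    E (DirectSum.decompose ℳ (a j) n : M)
  have h1 : ∀ g ∈ G, ∀ j, g • a j ∈ box φ a (e₁ + e₂) := by
    intro g hg j
    refine box_mono φ a ?_ (hE (g • a j))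
    refine le_trans ?_ (Nat.le_add_right _ _)
    refine le_trans ?_ (Finset.single_le_sum
      (f := fun g => ∑ j, E (g • a j)) (fun _ _ => Nat.zero_le _) hg)
    exact Finset.single_le_sum (f := fun j => E (g • a j))
      (fun _ _ => Nat.zero_le _) (Finset.mem_univ j)
  have h2 : ∀ j n, (DirectSum.decompose ℳ (a j) n : M) ∈ box φ a (e₁ + e₂) := by
    intro j n
    by_cases hn : n ∈ (DirectSum.decompose ℳ (a j)).support
    · refine box_mono φ a ?_ (hE _)
      refine le_trans ?_ (Nat.le_add_left _ _)
      refine le_trans ?_ (Finset.single_le_sum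
        (f := fun j => ∑ n ∈ (DirectSum.decompose ℳ (a j)).support,
          E (DirectSum.decompose ℳ (a j) n : M)) (fun _ _ => Nat.zero_le _) (Finset.mem_univ j))
      exact Finset.single_le_sum (f := fun n => E (DirectSum.decompose ℳ (a j) n : M))
        (fun _ _ => Nat.zero_le _) hn
    · rw [DFinsupp.notMem_support_iff] at hn
      rw [hn]
      exact zero_mem _
  have hF : ∀ g ∈ (G : Set S), ∀ n, ∀ x ∈ ℳ n ⊓ box φ a ((e₁ + e₂) * (n + 1)),
      g • x ∈ ℳ (n + 1) ⊓ box φ a ((e₁ + e₂) * (n + 1 + 1)) := by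
    rintro g hg n x ⟨hx, hx'⟩
    refine ⟨hdeg g hg n x hx, ?_⟩
    exact smul_mem_box φ a (h1 g hg) hx'
  have hle : ∀ n, ℳ n ≤ box φ a ((e₁ + e₂) * (n + 1)) := by
    intro n x hx
    -- The elements satisfying the bound in every degree form an `S`-submodule containing all `a j`,
    -- hence all of `M`.
    have hmem : x ∈ submoduleOfFamily ℳ hG hdeg
        (fun n => ℳ n ⊓ box φ a ((e₁ + e₂) * (n + 1))) hF := by
      obtain ⟨b, rfl⟩ := h x
      refine Submodule.sum_mem _ fun j _ => Submodule.smul_mem _ _ ?_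
      rw [mem_submoduleOfFamily]
      refine fun n => ⟨SetLike.coe_mem _, ?_⟩
      exact box_mono φ a (Nat.le_mul_of_pos_right _ n.succ_pos) (h2 j n)
    rw [mem_submoduleOfFamily_of_mem ℳ hG hdeg _ _ hx] at hmem
    exact hmem.2
  exact ⟨e₁ + e₂, fun n k hk => (hle k).trans (box_mono φ a (by gcongr))⟩

theorem sum_hilbertFunction_le_finrank {n : ℕ} {W : Submodule K M} [Module.Finite K W]
    (h : ∀ k ≤ n, ℳ k ≤ W) :
    ∑ k ∈ Finset.range (n + 1), hilbertFunction ℳ k ≤ Module.finrank K W := by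
  have hfin : ∀ k : Fin (n + 1), Module.Finite K (ℳ k) := fun k =>
    Submodule.finiteDimensional_of_le (h k (Nat.le_of_lt_succ k.2))
  let f : ((k : Fin (n + 1)) → ℳ k) →ₗ[K] W :=
    ∑ k : Fin (n + 1), (Submodule.inclusion (h k (Nat.le_of_lt_succ k.2))) ∘ₗ LinearMap.proj k
  have hf : Function.Injective f := by
    rw [← LinearMap.ker_eq_bot, LinearMap.ker_eq_bot']
    intro x hx
    funext k
    have h1 : ∑ i : Fin (n + 1), (x i : M) = 0 := by
      have := congrArg (Subtype.val) hx
      simpa [f] using this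
    have h2 := congrArg (fun y : M => (DirectSum.decompose ℳ y k : M)) h1
    simp only [DirectSum.decompose_sum, DirectSum.sum_apply, DirectSum.decompose_zero,
      DirectSum.zero_apply, Submodule.coe_sum, Submodule.coe_zero] at h2
    rw [Finset.sum_eq_single k] at h2
    · rw [DirectSum.decompose_of_mem_same _ (x k).2] at h2
      exact Subtype.ext h2
    · intro i _ hi
      exact DirectSum.decompose_of_mem_ne _ (x i).2 (fun h => hi (Fin.ext h))
    · simp
  have := LinearMap.finrank_le_finrank_of_injective hf
  rw [Module.finrank_pi_fintype] at this
  rwa [← Fin.sum_univ_eq_sum_range]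

end Box

variable (ℳ : ℕ → Submodule K M) [DirectSum.Decomposition ℳ]

/-- The elements whose homogeneous components of degree larger than `k` vanish. -/
def degreeLE (k : ℕ) : Submodule K M where
  carrier := {x | ∀ i, k < i → (DirectSum.decompose ℳ x i : M) = 0}
  zero_mem' := by simp
  add_mem' := by
    intro x y hx hy i hi
    rw [DirectSum.decompose_add, DirectSum.add_apply, Submodule.coe_add, hx i hi, hy i hi, add_zero]
  smul_mem' := by
    intro c x hx i hi
    rw [DirectSum.decompose_smul, DirectSum.smul_apply, Submodule.coe_smul, hx i hi, smul_zero]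

theorem degreeLE_mono {k l : ℕ} (h : k ≤ l) : degreeLE ℳ k ≤ degreeLE ℳ l :=
  fun _ hx i hi => hx i (h.trans_lt hi)

theorem exists_mem_degreeLE (x : M) : ∃ k, x ∈ degreeLE ℳ k := by
  classical
  refine ⟨(DirectSum.decompose ℳ x).support.sup id, fun i hi => ?_⟩
  by_contra h
  have : i ∈ (DirectSum.decompose ℳ x).support := by
    rw [DFinsupp.mem_support_iff]
    exact fun h0 => h (by rw [h0]; rfl)
  exact absurd (Finset.le_sup (f := id) this) (not_le.mpr hi)

/-- Multiplication by `s` raises degrees by at most `e`. -/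
def RaisesDegreeLE (s : S) (e : ℕ) : Prop :=
  ∀ k, ∀ x ∈ degreeLE ℳ k, s • x ∈ degreeLE ℳ (k + e)

variable {ℳ} in
theorem RaisesDegreeLE.mono {s : S} {e e' : ℕ} (h : RaisesDegreeLE ℳ s e) (he : e ≤ e') :
    RaisesDegreeLE ℳ s e' :=
  fun k x hx => degreeLE_mono ℳ (by omega) (h k x hx)

variable {ℳ} in
theorem RaisesDegreeLE.mul {s t : S} {e e' : ℕ} (h : RaisesDegreeLE ℳ s e)
    (h' : RaisesDegreeLE ℳ t e') : RaisesDegreeLE ℳ (s * t) (e + e') := by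
  intro k x hx
  rw [mul_smul, add_comm e, ← add_assoc]
  exact h _ _ (h' _ _ hx)

variable {ℳ} in
theorem RaisesDegreeLE.add {s t : S} {e : ℕ} (h : RaisesDegreeLE ℳ s e)
    (h' : RaisesDegreeLE ℳ t e) : RaisesDegreeLE ℳ (s + t) e := by
  intro k x hx
  rw [add_smul]
  exact add_mem (h _ _ hx) (h' _ _ hx)

theorem raisesDegreeLE_algebraMap (c : K) : RaisesDegreeLE ℳ (algebraMap K S c) 0 := by
  intro k x hx
  rw [algebraMap_smul]
  exact Submodule.smul_mem _ _ hx

variable {ℳ} in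
theorem RaisesDegreeLE.pow {s : S} {e : ℕ} (h : RaisesDegreeLE ℳ s e) (n : ℕ) :
    RaisesDegreeLE ℳ (s ^ n) (n * e) := by
  induction n with
  | zero => simpa using raisesDegreeLE_algebraMap ℳ (S := S) (1 : K)
  | succ n ih =>
    rw [pow_succ, add_mul, one_mul]
    exact ih.mul h

variable {ℳ} in
theorem RaisesDegreeLE.prod {ι : Type*} (T : Finset ι) {s : ι → S} {e : ι → ℕ}
    (h : ∀ i ∈ T, RaisesDegreeLE ℳ (s i) (e i)) :
    RaisesDegreeLE ℳ (∏ i ∈ T, s i) (∑ i ∈ T, e i) := by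
  classical
  induction T using Finset.induction_on with
  | empty => simpa using raisesDegreeLE_algebraMap ℳ (S := S) (1 : K)
  | insert i T hi ih =>
    rw [Finset.prod_insert hi, Finset.sum_insert hi]
    exact (h i (by simp)).mul (ih fun j hj => h j (by simp [hj]))

theorem exists_raisesDegreeLE {G : Set S} (hG : Algebra.adjoin K G = ⊤)
    (hdeg : ∀ g ∈ G, ∀ n, ∀ x ∈ ℳ n, g • x ∈ ℳ (n + 1)) (s : S) :
    ∃ e, RaisesDegreeLE ℳ s e := by
  have hs : s ∈ Algebra.adjoin K G := by rw [hG]; trivial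
  induction hs using Algebra.adjoin_induction with
  | mem g hg =>
    refine ⟨1, fun k x hx i hi => ?_⟩
    obtain ⟨i, rfl⟩ : ∃ j, i = j + 1 := ⟨i - 1, by omega⟩
    rw [decompose_smul_succ ℳ (hdeg g hg), hx i (by omega), smul_zero]
  | algebraMap r => exact ⟨0, raisesDegreeLE_algebraMap ℳ r⟩
  | add a b _ _ ha hb =>
    obtain ⟨e, he⟩ := ha
    obtain ⟨e', he'⟩ := hb
    exact ⟨e + e', (he.mono (by omega)).add (he'.mono (by omega))⟩
  | mul a b _ _ ha hb =>
    obtain ⟨e, he⟩ := ha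
    obtain ⟨e', he'⟩ := hb
    exact ⟨e + e', he.mul he'⟩

/-- By faithfulness, `b ↦ (φ b • a j)_j` is injective on polynomials of partial degrees at most `n`.
Its values live in degrees at most linear in `n`, because each `φ (X i)` raises degrees by a bounded
amount. -/
theorem exists_pow_le_sum_hilbertFunction (hfin : ∀ n, Module.Finite K (ℳ n)) {m r : ℕ}
    (φ : MvPolynomial (Fin m) K →ₐ[K] S) (a : Fin r → M)
    (h : ∀ x, ∃ b : Fin r → MvPolynomial (Fin m) K, x = ∑ j, φ (b j) • a j)
    (hφ : ∀ b, (∀ x : M, φ b • x = 0) → b = 0)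
    {G : Set S} (hG : Algebra.adjoin K G = ⊤)
    (hdeg : ∀ g ∈ G, ∀ n, ∀ x ∈ ℳ n, g • x ∈ ℳ (n + 1)) :
    ∃ c, ∀ n, (n + 1) ^ m ≤
      r * ∑ k ∈ Finset.range (c * (n + 1) + 1), hilbertFunction ℳ k := by
  choose c hc using fun j => exists_mem_degreeLE ℳ (a j)
  choose e he using fun i => exists_raisesDegreeLE ℳ hG hdeg (φ (MvPolynomial.X i))
  -- A monomial with exponents at most `n` sends `a j` into degrees at most `c j + n * ∑ e i`, which
  -- is at most `C * (n + 1)`.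
  let C := ∑ j, c j + ∑ i, e i
  have hbound : ∀ n, ∀ b ∈ MvPolynomial.restrictDegree (Fin m) K n, ∀ j,
      φ b • a j ∈ degreeLE ℳ (C * (n + 1)) := by
    intro n b hb j
    rw [MvPolynomial.as_sum b, map_sum, Finset.sum_smul]
    refine Submodule.sum_mem _ fun v hv => ?_
    have hv' := (MvPolynomial.mem_restrictDegree _ _ _).mp hb v hv
    rw [MvPolynomial.monomial_eq, ← MvPolynomial.algebraMap_eq, map_mul, AlgHom.commutes,
      Finsupp.prod_fintype _ _ (by simp), map_prod]
    have h1 : RaisesDegreeLE ℳ (algebraMap K S (MvPolynomial.coeff v b) *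
        ∏ i, φ (MvPolynomial.X i ^ v i)) (0 + ∑ i, v i * e i) := by
      refine (raisesDegreeLE_algebraMap ℳ _).mul (RaisesDegreeLE.prod _ fun i _ => ?_)
      rw [map_pow]
      exact (he i).pow _
    refine degreeLE_mono ℳ ?_ (h1 _ _ (hc j))
    have h2 : c j ≤ ∑ j, c j := Finset.single_le_sum (f := c) (fun _ _ => Nat.zero_le _)
      (Finset.mem_univ j)
    have h3 : ∑ i, v i * e i ≤ n * ∑ i, e i := by
      rw [Finset.mul_sum]
      exact Finset.sum_le_sum fun i _ => Nat.mul_le_mul_right _ (hv' i)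
    simp only [C]
    nlinarith [Nat.zero_le (n * ∑ j, c j), Nat.zero_le (∑ i, e i)]
  refine ⟨C, fun n => ?_⟩
  let p : (i : ℕ) → M →ₗ[K] ℳ i := fun i =>
    DirectSum.component K ℕ (fun i => ℳ i) i ∘ₗ (DirectSum.decomposeLinearEquiv ℳ).toLinearMap
  let f : MvPolynomial.restrictDegree (Fin m) K n →ₗ[K]
      (Fin r → (k : Fin (C * (n + 1) + 1)) → ℳ k) :=
    LinearMap.pi fun j => LinearMap.pi fun k => p k ∘ₗ
      ((LinearMap.toSpanSingleton S M (a j)).restrictScalars K) ∘ₗ φ.toLinearMap ∘ₗ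
        Submodule.subtype _
  have hf : ∀ b j (k : Fin (C * (n + 1) + 1)), ((f b j k : ℳ k) : M) =
    DirectSum.decompose ℳ (φ (b : MvPolynomial (Fin m) K) • a j) k := fun b j k => rfl
  have hinj : Function.Injective f := by
    rw [← LinearMap.ker_eq_bot, LinearMap.ker_eq_bot']
    intro b hb
    have h0 : ∀ j, φ (b : MvPolynomial (Fin m) K) • a j = 0 := by
      intro j
      apply (DirectSum.decompose ℳ).injective
      rw [DirectSum.decompose_zero]
      refine DFinsupp.ext fun i => Subtype.ext ?_
      by_cases hi : i < C * (n + 1) + 1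
      · rw [← hf b j ⟨i, hi⟩, hb]
        rfl
      · exact hbound n b b.2 j i (by omega)
    refine Subtype.ext (hφ _ fun x => ?_)
    obtain ⟨b', rfl⟩ := h x
    rw [Finset.smul_sum]
    refine Finset.sum_eq_zero fun j _ => ?_
    rw [smul_comm, h0, smul_zero]
  have := LinearMap.finrank_le_finrank_of_injective hinj
  rw [finrank_restrictDegree, Module.finrank_pi_fintype, Finset.sum_const, Finset.card_univ,
    Fintype.card_fin, smul_eq_mul, Module.finrank_pi_fintype] at this
  rwa [← Fin.sum_univ_eq_sum_range]

end Growth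

/-! ### Rationality of the Hilbert series -/

section HilbertSerre

theorem finrank_map_add_finrank_inf_ker {K V W : Type*} [Field K] [AddCommGroup V] [Module K V]
    [AddCommGroup W] [Module K W] (f : V →ₗ[K] W) (U : Submodule K V) [Module.Finite K U] :
    Module.finrank K (U.map f) + Module.finrank K (U ⊓ LinearMap.ker f : Submodule K V) =
      Module.finrank K U := by
  rw [← LinearMap.finrank_range_add_finrank_ker (f.domRestrict U), LinearMap.range_domRestrict,
    LinearMap.ker_domRestrict]
  rw [← Submodule.finrank_map_subtype_eq U, Submodule.map_comap_subtype]

theorem exists_polynomial_of_eventually_eq_zero {R : Type*} [CommRing R] (u : ℕ → R) (n₀ : ℕ)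
    (h : ∀ n, n₀ ≤ n → u n = 0) :
    ∃ p : Polynomial R, PowerSeries.mk u = (p : PowerSeries R) := by
  refine ⟨PowerSeries.trunc n₀ (PowerSeries.mk u), ?_⟩
  ext n
  rw [Polynomial.coeff_coe, PowerSeries.coeff_trunc, PowerSeries.coeff_mk]
  split_ifs with hn
  · rfl
  · exact h n (not_lt.mp hn)

variable {K S M : Type*} [Field K] [CommRing S] [Algebra K S] [AddCommGroup M] [Module K M]
  [Module S M] [IsScalarTower K S M] (ℳ : ℕ → Submodule K M) [DirectSum.Decomposition ℳ]

/-- The cokernel family: `N + g L`, with a degree shift. -/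
def supShift (N L : ℕ → Submodule K M) (g : S) : ℕ → Submodule K M
  | 0 => N 0
  | n + 1 => N (n + 1) ⊔ (L n).map (LinearMap.lsmul S M g |>.restrictScalars K)

theorem le_supShift (N L : ℕ → Submodule K M) (g : S) (n : ℕ) : N n ≤ supShift N L g n := by
  cases n with
  | zero => exact le_rfl
  | succ n => exact le_sup_left

theorem smul_mem_supShift (N L : ℕ → Submodule K M) (g : S) (n : ℕ) {x : M} (hx : x ∈ L n) :
    g • x ∈ supShift N L g (n + 1) :=
  Submodule.mem_sup_right ⟨x, hx, rfl⟩

/-- Rank-nullity for multiplication by `g` from `L n` to `M / N (n + 1)`: the kernel is the infimum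
displayed, the image is `supShift N L g (n + 1) / N (n + 1)`. -/
theorem finrank_supShift (N L : ℕ → Submodule K M) (g : S) (n : ℕ) [Module.Finite K (L n)]
    [Module.Finite K (N (n + 1))] :
    Module.finrank K (supShift N L g (n + 1)) +
      Module.finrank K (L n ⊓ (N (n + 1)).comap (LinearMap.lsmul S M g |>.restrictScalars K) :
        Submodule K M) = Module.finrank K (N (n + 1)) + Module.finrank K (L n) := by
  set γ : M →ₗ[K] M := (LinearMap.lsmul S M g).restrictScalars K
  have h1 := finrank_map_add_finrank_inf_ker ((N (n + 1)).mkQ ∘ₗ γ) (L n)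
  have hU : Module.Finite K (supShift N L g (n + 1)) := by
    unfold supShift
    infer_instance
  have h2 := finrank_map_add_finrank_inf_ker ((N (n + 1)).mkQ) (supShift N L g (n + 1))
  rw [LinearMap.ker_comp, Submodule.ker_mkQ, Submodule.map_comp] at h1
  rw [Submodule.ker_mkQ, inf_eq_right.mpr (le_supShift N L g (n + 1))] at h2
  have h3 : (supShift N L g (n + 1)).map (N (n + 1)).mkQ = ((L n).map γ).map (N (n + 1)).mkQ := by
    rw [supShift, Submodule.map_sup, Submodule.mkQ_map_self, bot_sup_eq]
  rw [h3] at h2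
  omega

/-- Hilbert-Serre for a quotient `L / N` of stable families of homogeneous subspaces on which the
generators outside of `T` act as zero. -/
theorem exists_polynomial_of_stable [IsNoetherian S M] (hfin : ∀ n, Module.Finite K (ℳ n))
    {G : Set S} (hG : Algebra.adjoin K G = ⊤)
    (hdeg : ∀ g ∈ G, ∀ n, ∀ x ∈ ℳ n, g • x ∈ ℳ (n + 1)) (T : Finset S) (hT : (T : Set S) ⊆ G) :
    ∀ N L : ℕ → Submodule K M, (∀ n, N n ≤ L n) → (∀ n, L n ≤ ℳ n) →
      (∀ g ∈ G, ∀ n, ∀ x ∈ N n, g • x ∈ N (n + 1)) →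
      (∀ g ∈ G, ∀ n, ∀ x ∈ L n, g • x ∈ L (n + 1)) →
      (∀ g ∈ G, g ∉ T → ∀ n, ∀ x ∈ L n, g • x ∈ N (n + 1)) →
      ∃ p : Polynomial ℤ, (1 - PowerSeries.X) ^ T.card *
        PowerSeries.mk (fun n => (Module.finrank K (L n) : ℤ) - Module.finrank K (N n)) =
          (p : PowerSeries ℤ) := by
  classical
  induction T using Finset.induction_on with
  | empty =>
    intro N L hNL hL _ _ h
    -- With no active generator left, `L / N` vanishes in large degrees and its series is a
    -- polynomial.
    obtain ⟨n₀, hn₀⟩ := eventually_le_of_smul_le ℳ hG hdeg N L hL hNL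
      (fun g hg => h g hg (by simp))
    simp only [Finset.card_empty, pow_zero, one_mul]
    refine exists_polynomial_of_eventually_eq_zero _ n₀ fun n hn => ?_
    rw [le_antisymm (hNL n) (hn₀ n hn), sub_self]
  | insert g T hgT ih =>
    intro N L hNL hL hN hLs h
    have hgG : g ∈ G := hT (by simp)
    have ih := ih (fun x hx => hT (by simp [Finset.mem_coe.mp hx]))
    -- `L' / N` is the kernel and `L / N'` the cokernel of `g` on `L / N`. Both are killed by `g`,
    -- so the induction hypothesis for `T` applies to each.
    let L' : ℕ → Submodule K M := fun n =>
      L n ⊓ (N (n + 1)).comap (LinearMap.lsmul S M g |>.restrictScalars K)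
    let N' := supShift N L g
    have hN'L : ∀ n, N' n ≤ L n := by
      rintro (_ | n)
      · exact hNL 0
      · refine sup_le (hNL _) ?_
        rintro _ ⟨x, hx, rfl⟩
        exact hLs g hgG n x hx
    obtain ⟨p, hp⟩ := ih N L'
      (fun n x hx => ⟨hNL n hx, hN g hgG n x hx⟩)
      (fun n => inf_le_left.trans (hL n)) hN
      (by
        rintro k hk n x ⟨hx, hx'⟩
        refine ⟨hLs k hk n x hx, ?_⟩
        change g • k • x ∈ N (n + 1 + 1)
        rw [smul_comm]
        exact hN k hk _ _ hx')
      (by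
        rintro k hk hkT n x ⟨hx, hx'⟩
        by_cases hkg : k = g
        · subst hkg; exact hx'
        · exact h k hk (by simp [hkg, hkT]) n x hx)
    obtain ⟨q, hq⟩ := ih N' L hN'L hL
      (by
        rintro k hk (_ | n) x hx
        · exact le_supShift N L g 1 (hN k hk 0 x hx)
        · obtain ⟨y, hy, _, ⟨z, hz, rfl⟩, rfl⟩ := Submodule.mem_sup.mp hx
          rw [smul_add]
          refine add_mem (le_supShift N L g _ (hN k hk _ y hy)) ?_
          change k • g • z ∈ _
          rw [smul_comm]
          exact smul_mem_supShift N L g _ (hLs k hk n z hz))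
      hLs
      (by
        intro k hk hkT n x hx
        by_cases hkg : k = g
        · subst hkg; exact smul_mem_supShift N L k n hx
        · exact le_supShift N L g _ (h k hk (by simp [hkg, hkT]) n x hx))
    have hLf : ∀ n, Module.Finite K (L n) := fun n =>
      have := hfin n
      Submodule.finiteDimensional_of_le (hL n)
    have hNf : ∀ n, Module.Finite K (N n) := fun n =>
      have := hLf n
      Submodule.finiteDimensional_of_le (hNL n)
    -- The four-term exact sequence of multiplication by `g`, whose source is shifted by one degree,
    -- read off on dimensions.
    have key : (1 - PowerSeries.X) *
        PowerSeries.mk (fun n => (Module.finrank K (L n) : ℤ) - Module.finrank K (N n)) =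
      PowerSeries.mk (fun n => (Module.finrank K (L n) : ℤ) - Module.finrank K (N' n)) -
      PowerSeries.X * PowerSeries.mk
        (fun n => (Module.finrank K (L' n) : ℤ) - Module.finrank K (N n)) := by
      ext n
      rw [sub_mul, one_mul]
      cases n with
      | zero =>
        simp only [map_sub, PowerSeries.coeff_zero_X_mul, PowerSeries.coeff_mk]
        rfl
      | succ n =>
        simp only [map_sub, PowerSeries.coeff_succ_X_mul, PowerSeries.coeff_mk]
        have := finrank_supShift N L g n
        have h2 : Module.finrank K (N' (n + 1)) + Module.finrank K (L' n) =
          Module.finrank K (N (n + 1)) + Module.finrank K (L n) := this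
        have h3 : (Module.finrank K (N' (n + 1)) : ℤ) + Module.finrank K (L' n) =
          Module.finrank K (N (n + 1)) + Module.finrank K (L n) := by exact_mod_cast h2
        linarith
    refine ⟨q - Polynomial.X * p, ?_⟩
    rw [Finset.card_insert_of_notMem hgT, pow_succ, mul_assoc, key, mul_sub, hq, mul_left_comm, hp]
    simp

theorem exists_pow_mul_hilbertSeries_eq [IsNoetherian S M] (hfin : ∀ n, Module.Finite K (ℳ n))
    {G : Finset S} (hG : Algebra.adjoin K (G : Set S) = ⊤)
    (hdeg : ∀ g ∈ (G : Set S), ∀ n, ∀ x ∈ ℳ n, g • x ∈ ℳ (n + 1)) :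
    ∃ p : Polynomial ℤ, (1 - PowerSeries.X) ^ G.card * hilbertSeries ℳ = (p : PowerSeries ℤ) := by
  obtain ⟨p, hp⟩ := exists_polynomial_of_stable ℳ hfin hG hdeg G subset_rfl (fun _ => ⊥) ℳ
    (fun _ => bot_le) (fun _ => le_rfl)
    (fun g _ n x hx => by
      rw [(Submodule.mem_bot K).mp hx, smul_zero]
      exact zero_mem _) hdeg (fun g hg hg' => absurd hg hg')
  refine ⟨p, ?_⟩
  rw [← hp]
  congr 1
  ext n
  simp [hilbertSeries, hilbertFunction]

end HilbertSerre

/-! ### Pole order at `1`, Hilbert polynomial and its coefficients -/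

section HilbertPolynomial

open Polynomial in
theorem eventually_eval_hilbertPoly {F : Type*} [Field F] [CharZero F] {u : ℕ → ℤ}
    {h : Polynomial ℤ} {d : ℕ}
    (hu : (1 - PowerSeries.X) ^ d * PowerSeries.mk u = (h : PowerSeries ℤ)) :
    ∀ᶠ n : ℕ in atTop, (hilbertPoly (h.map (Int.castRingHom F)) d).eval (n : F) = u n := by
  have h1 : (1 - PowerSeries.X) ^ d * PowerSeries.mk (fun n => (u n : F)) =
      ((h.map (Int.castRingHom F) : Polynomial F) : PowerSeries F) := by
    have := congrArg (PowerSeries.map (Int.castRingHom F)) hu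
    rw [map_mul, map_pow, map_sub, map_one, PowerSeries.map_X] at this
    rw [Polynomial.polynomial_map_coe, ← this]
    congr 1
  have h2 : PowerSeries.mk (fun n => (u n : F)) =
      (h.map (Int.castRingHom F) : Polynomial F) * (PowerSeries.invOneSubPow F d : PowerSeries F) := by
    rw [← h1, ← PowerSeries.invOneSubPow_inv_eq_one_sub_pow, mul_right_comm,
      Units.inv_eq_val_inv, Units.inv_mul, one_mul]
  filter_upwards [eventually_gt_atTop (h.map (Int.castRingHom F)).natDegree] with n hn
  rw [← coeff_mul_invOneSubPow_eq_hilbertPoly_eval d hn, ← h2, PowerSeries.coeff_mk]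

open Polynomial in
theorem natDegree_hilbertPoly_le {F : Type*} [Field F] [CharZero F] (p : Polynomial F) (d : ℕ) :
    (hilbertPoly p (d + 1)).natDegree ≤ d := by
  rw [hilbertPoly_succ]
  refine natDegree_sum_le_of_forall_le _ _ fun i _ => (natDegree_smul_le _ _).trans ?_
  rw [natDegree_preHilbertPoly]

open Polynomial in
-- Each shifted binomial polynomial has leading coefficient `1 / d!`, so the weights `p.coeff i`
-- simply add up to `p(1)`.
theorem coeff_hilbertPoly {F : Type*} [Field F] [CharZero F] (p : Polynomial F) (d : ℕ) :
    (hilbertPoly p (d + 1)).coeff d = p.eval 1 * (d.factorial : F)⁻¹ := by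
  rw [hilbertPoly_succ]
  simp only [finsetSum_coeff, coeff_smul, smul_eq_mul, coeff_preHilbertPoly_self]
  rw [← Finset.sum_mul, eval_eq_sum, sum_def]
  simp

open Polynomial in
theorem natDegree_le_of_eventually_le {P Q : Polynomial ℝ}
    (hpos : ∀ᶠ n : ℕ in atTop, 0 < P.eval (n : ℝ))
    (h : ∀ᶠ n : ℕ in atTop, P.eval (n : ℝ) ≤ Q.eval (n : ℝ)) : P.natDegree ≤ Q.natDegree := by
  by_contra hlt
  rw [not_le] at hlt
  have h1 := (div_tendsto_atTop_zero_of_degree_lt Q P (degree_lt_degree hlt)).comp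
    (tendsto_natCast_atTop_atTop (R := ℝ))
  have h2 : ∀ᶠ n : ℕ in atTop, Q.eval (n : ℝ) / P.eval (n : ℝ) < 1 :=
    h1.eventually (gt_mem_nhds one_pos)
  obtain ⟨n, hn, hn', hn''⟩ := (hpos.and (h.and h2)).exists
  rw [div_lt_one hn] at hn''
  linarith

/-- After cancelling factors `1 - t`, a pole of exact order `d` remains. Partial sums of `u` are
then eventually a polynomial of degree `d`, and the two growth bounds force `d = m`. -/
theorem exists_numerator {u : ℕ → ℕ} {m r R : ℕ} (hm : 1 ≤ m) {p : Polynomial ℤ}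
    (hp : (1 - PowerSeries.X) ^ r * PowerSeries.mk (fun n => (u n : ℤ)) = (p : PowerSeries ℤ))
    (hlow : ∃ c, ∀ n, (n + 1) ^ m ≤ R * ∑ k ∈ Finset.range (c * (n + 1) + 1), u k)
    (hup : ∃ e, ∀ n, ∑ k ∈ Finset.range (n + 1), u k ≤ R * (e * (n + 1) + 1) ^ m) :
    ∃ h : Polynomial ℤ, (1 - PowerSeries.X) ^ m * PowerSeries.mk (fun n => (u n : ℤ)) =
      (h : PowerSeries ℤ) ∧ h.eval 1 ≠ 0 := by
  obtain ⟨c, hc⟩ := hlow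
  obtain ⟨e, he⟩ := hup
  have hmono : Monotone fun n => ∑ k ∈ Finset.range n, u k := fun a b hab =>
    Finset.sum_le_sum_of_subset (Finset.range_subset_range.mpr hab)
  have hX : (1 - PowerSeries.X : PowerSeries ℤ) ≠ 0 := by
    intro h0
    have := congrArg (PowerSeries.coeff 0) h0
    simp at this
  -- Evaluating the lower bound at `n = R * B` would give `R * B + 1 ≤ R * B`; this needs `m ≥ 1`.
  have hnz : ¬ ∃ B, ∀ n, ∑ k ∈ Finset.range n, u k ≤ B := by
    rintro ⟨B, hB⟩
    have h1 := (hc (R * B)).trans (Nat.mul_le_mul_left R (hB _))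
    have h2 : R * B + 1 ≤ (R * B + 1) ^ m := Nat.le_self_pow (by omega) _
    omega
  have hbdd : ∀ q : Polynomial ℤ, PowerSeries.mk (fun n => (u n : ℤ)) ≠ (q : PowerSeries ℤ) := by
    intro q hq
    refine hnz ⟨∑ k ∈ Finset.range (q.natDegree + 1), u k, fun n => ?_⟩
    have hz : ∀ k, q.natDegree < k → u k = 0 := by
      intro k hk
      have := congrArg (PowerSeries.coeff k) hq
      rw [PowerSeries.coeff_mk, Polynomial.coeff_coe, Polynomial.coeff_eq_zero_of_natDegree_lt hk]
        at this
      exact_mod_cast this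
    refine Finset.sum_le_sum_of_ne_zero fun k _ hk => ?_
    rw [Finset.mem_range]
    by_contra h
    exact hk (hz k (by omega))
  have hp0 : p ≠ 0 := by
    rintro rfl
    rw [Polynomial.coe_zero, mul_eq_zero] at hp
    exact hbdd 0 (by simpa using hp.resolve_left (pow_ne_zero _ hX))
  obtain ⟨q, hq, hq'⟩ := Polynomial.exists_eq_pow_rootMultiplicity_mul_and_not_dvd p hp0 1
  set k := p.rootMultiplicity 1
  -- The sign converts powers of `X - 1` into powers of `1 - X`.
  let h : Polynomial ℤ := (-1) ^ k * q
  have hh : h.eval 1 ≠ 0 := by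
    simp only [h, Polynomial.eval_mul, Polynomial.eval_pow, Polynomial.eval_neg,
      Polynomial.eval_one]
    refine mul_ne_zero (pow_ne_zero _ (by norm_num)) ?_
    exact fun h0 => hq' (Polynomial.dvd_iff_isRoot.mpr h0)
  have hph : (p : PowerSeries ℤ) = (1 - PowerSeries.X) ^ k * (h : PowerSeries ℤ) := by
    have h1 : p = (1 - Polynomial.X) ^ k * h := by
      rw [hq]
      simp only [h, Polynomial.C_1]
      rw [← mul_assoc, ← mul_pow]
      ring
    rw [h1]
    simp
  rw [hph] at hp
  -- Otherwise the series would be a polynomial and the partial sums would be bounded.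
  have hkr : k < r := by
    by_contra hkr
    rw [not_lt] at hkr
    obtain ⟨j, hj⟩ := Nat.exists_eq_add_of_le hkr
    rw [hj, pow_add, mul_assoc] at hp
    refine hbdd ((1 - Polynomial.X) ^ j * h) ?_
    rw [mul_left_cancel₀ (pow_ne_zero _ hX) hp]
    simp
  obtain ⟨d, hd⟩ := Nat.exists_eq_add_of_le hkr.le
  rw [hd, pow_add, mul_assoc] at hp
  have hp := mul_left_cancel₀ (pow_ne_zero _ hX) hp
  -- Dividing by `1 - X` takes partial sums, hence the exponent `d + 1` and degree exactly `d`,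
  -- including when `d = 0`.
  have hsum : (1 - PowerSeries.X) ^ (d + 1) *
      PowerSeries.mk (fun n => ((∑ k ∈ Finset.range (n + 1), u k : ℕ) : ℤ)) =
      (h : PowerSeries ℤ) := by
    rw [← hp, pow_succ, mul_assoc]
    congr 1
    ext n
    rw [sub_mul, one_mul, map_sub]
    cases n with
    | zero => simp
    | succ n =>
      rw [PowerSeries.coeff_succ_X_mul, PowerSeries.coeff_mk, PowerSeries.coeff_mk,
        PowerSeries.coeff_mk, Finset.sum_range_succ _ (n + 1)]
      push_cast
      ring
  set Q := Polynomial.hilbertPoly (h.map (Int.castRingHom ℝ)) (d + 1)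
  have hQ : ∀ᶠ n : ℕ in atTop, Q.eval (n : ℝ) = ((∑ k ∈ Finset.range (n + 1), u k : ℕ) : ℝ) := by
    simpa using eventually_eval_hilbertPoly (F := ℝ) hsum
  have hcoeff : Q.coeff d ≠ 0 := by
    rw [coeff_hilbertPoly]
    refine mul_ne_zero ?_ (inv_ne_zero (by exact_mod_cast d.factorial_ne_zero))
    have h2 : (h.map (Int.castRingHom ℝ)).eval 1 = ((h.eval 1 : ℤ) : ℝ) := by
      simp
    rw [h2]
    exact_mod_cast hh
  have hQd : Q.natDegree = d :=
    le_antisymm (natDegree_hilbertPoly_le _ _) (Polynomial.le_natDegree_of_ne_zero hcoeff)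
  have hQpos : ∀ᶠ n : ℕ in atTop, 0 < Q.eval (n : ℝ) := by
    have : ∃ n₀, 0 < ∑ k ∈ Finset.range n₀, u k := by
      by_contra hcon
      push Not at hcon
      exact hnz ⟨0, hcon⟩
    obtain ⟨n₀, hn₀⟩ := this
    filter_upwards [hQ, eventually_ge_atTop n₀] with n hn hn'
    rw [hn]
    exact_mod_cast hn₀.trans_le (hmono (by omega))
  have hdm : d ≤ m := by
    rw [← hQd]
    have h1 : (Polynomial.C (R : ℝ) * (Polynomial.C (e : ℝ) * (Polynomial.X + 1) + 1) ^ m).natDegree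
        ≤ m := by
      compute_degree
    refine (natDegree_le_of_eventually_le hQpos ?_).trans h1
    filter_upwards [hQ] with n hn
    rw [hn]
    simp only [Polynomial.eval_mul, Polynomial.eval_C, Polynomial.eval_pow, Polynomial.eval_add,
      Polynomial.eval_X, Polynomial.eval_one]
    exact_mod_cast he n
  have hmd : m ≤ d := by
    have h1 : ((Polynomial.X + 1 : Polynomial ℝ) ^ m).natDegree = m := by
      rw [← Polynomial.C_1, Polynomial.natDegree_pow, Polynomial.natDegree_X_add_C, mul_one]
    have h2 : (Polynomial.C (R : ℝ) *
        Q.comp (Polynomial.C ((c : ℝ) + 1) * (Polynomial.X + 1))).natDegree ≤ d := by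
      refine (Polynomial.natDegree_C_mul_le _ _).trans ?_
      rw [Polynomial.natDegree_comp, hQd]
      refine (Nat.mul_le_mul_left d (?_ : _ ≤ 1)).trans (mul_one d).le
      compute_degree
    refine h1.symm.le.trans ((natDegree_le_of_eventually_le ?_ ?_).trans h2)
    · filter_upwards with n
      simp only [Polynomial.eval_pow, Polynomial.eval_add, Polynomial.eval_X, Polynomial.eval_one]
      positivity
    -- Using `c + 1` instead of `c` makes the argument tend to infinity even if `c = 0`;
    -- monotonicity of partial sums absorbs the change.
    · have ht : Tendsto (fun n : ℕ => (c + 1) * (n + 1)) atTop atTop :=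
        tendsto_atTop_mono (fun n => by simp only [id]; nlinarith [Nat.zero_le (c * n)]) tendsto_id
      filter_upwards [ht.eventually hQ] with n hn
      push_cast at hn
      simp only [Polynomial.eval_mul, Polynomial.eval_C, Polynomial.eval_pow, Polynomial.eval_add,
        Polynomial.eval_X, Polynomial.eval_one, Polynomial.eval_comp]
      rw [hn]
      exact_mod_cast (hc n).trans (Nat.mul_le_mul_left R (hmono (by nlinarith)))
  obtain rfl : d = m := le_antisymm hdm hmd
  exact ⟨h, hp, hh⟩

/-- The binomial polynomials have one member in each degree below `m`, so top coefficients can be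
peeled off one by one. -/
theorem exists_smul_preHilbertPoly (m : ℕ) :
    ∀ P : Polynomial ℚ, P.degree < m → ∃ c : ℕ → ℚ,
      P = ∑ k ∈ Finset.range m, c k • Polynomial.preHilbertPoly ℚ (m - 1 - k) 0 := by
  induction m with
  | zero =>
    intro P hP
    refine ⟨0, ?_⟩
    simpa using hP
  | succ m ih =>
    intro P hP
    have hf : (m.factorial : ℚ) ≠ 0 := by exact_mod_cast m.factorial_ne_zero
    let a := P.coeff m * m.factorial
    obtain ⟨c, hc⟩ := ih (P - a • Polynomial.preHilbertPoly ℚ m 0) (by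
      rw [Polynomial.degree_lt_iff_coeff_zero]
      intro k hk
      rw [Polynomial.coeff_sub, Polynomial.coeff_smul, smul_eq_mul]
      rcases hk.eq_or_lt with rfl | hk
      · rw [Polynomial.coeff_preHilbertPoly_self]
        field_simp [a]
        simp [a]
      · rw [Polynomial.coeff_eq_zero_of_natDegree_lt (p := Polynomial.preHilbertPoly ℚ m 0)
          (by rwa [Polynomial.natDegree_preHilbertPoly]), mul_zero, sub_zero]
        exact (Polynomial.degree_lt_iff_coeff_zero _ _).mp hP k hk)
    refine ⟨fun k => if k = 0 then a else c (k - 1), ?_⟩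
    rw [Finset.sum_range_succ']
    simp only [Nat.add_eq_zero_iff, one_ne_zero, and_false, if_false, Nat.add_sub_cancel, if_true,
      Nat.sub_zero]
    rw [sub_eq_iff_eq_add] at hc
    rw [hc]
    congr 1
    · refine Finset.sum_congr rfl fun k _ => ?_
      rw [show m - 1 - k = m - (k + 1) by omega]

variable {K M : Type*} [Field K] [AddCommGroup M] [Module K M] {ℳ : ℕ → Submodule K M}

theorem IsHilbertPolynomial.unique {P Q : Polynomial ℚ} (hP : IsHilbertPolynomial ℳ P)
    (hQ : IsHilbertPolynomial ℳ Q) : P = Q := by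
  obtain ⟨n₀, hn₀⟩ := eventually_atTop.mp (hP.and hQ)
  apply Polynomial.eq_of_infinite_eval_eq P Q
  apply ((Set.Ici_infinite n₀).image (Nat.cast_injective (R := ℚ)).injOn).mono
  rintro x ⟨n, hn, rfl⟩
  obtain ⟨h1, h2⟩ := hn₀ n hn
  exact h1.trans h2.symm

theorem IsHilbertNumerator.isHilbertPolynomial {m : ℕ} {h : Polynomial ℤ}
    (hh : IsHilbertNumerator ℳ m h) :
    IsHilbertPolynomial ℳ (Polynomial.hilbertPoly (h.map (Int.castRingHom ℚ)) m) := by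
  have := eventually_eval_hilbertPoly (F := ℚ) hh.1
  simpa [IsHilbertPolynomial] using this

theorem isHilbertNumerator_hilbertNumerator {m : ℕ} (h : ∃ p, IsHilbertNumerator ℳ m p) :
    IsHilbertNumerator ℳ m (hilbertNumerator ℳ m) := by
  rw [hilbertNumerator, dif_pos h]
  exact h.choose_spec

theorem isHilbertPolynomial_hilbertPolynomial {m : ℕ} (h : ∃ p, IsHilbertNumerator ℳ m p) :
    IsHilbertPolynomial ℳ (hilbertPolynomial ℳ) := by
  obtain ⟨p, hp⟩ := h
  have hex : ∃ P, IsHilbertPolynomial ℳ P := ⟨_, hp.isHilbertPolynomial⟩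
  rw [hilbertPolynomial, dif_pos hex]
  exact hex.choose_spec

theorem hilbertPolynomial_eq {m : ℕ} (h : ∃ p, IsHilbertNumerator ℳ m p) :
    hilbertPolynomial ℳ =
      Polynomial.hilbertPoly ((hilbertNumerator ℳ m).map (Int.castRingHom ℚ)) m :=
  (isHilbertPolynomial_hilbertPolynomial h).unique
    (isHilbertNumerator_hilbertNumerator h).isHilbertPolynomial

theorem multiplicity_eq_factorial_mul_coeff {m : ℕ} (hm : 1 ≤ m)
    (h : ∃ p, IsHilbertNumerator ℳ m p) :
    (multiplicity ℳ m : ℚ) = ((m - 1).factorial : ℚ) * (hilbertPolynomial ℳ).coeff (m - 1) := by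
  obtain ⟨d, rfl⟩ := Nat.exists_eq_add_of_le' hm
  have hf : (d.factorial : ℚ) ≠ 0 := by exact_mod_cast d.factorial_ne_zero
  rw [hilbertPolynomial_eq h, Nat.add_sub_cancel, coeff_hilbertPoly, multiplicity]
  have h2 : ((hilbertNumerator ℳ (d + 1)).map (Int.castRingHom ℚ)).eval 1 =
      (((hilbertNumerator ℳ (d + 1)).eval 1 : ℤ) : ℚ) := by
    simp
  rw [h2]
  field_simp

theorem degree_hilbertPolynomial {m : ℕ} (hm : 1 ≤ m) (h : ∃ p, IsHilbertNumerator ℳ m p) :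
    (hilbertPolynomial ℳ).degree = ((m - 1 : ℕ) : WithBot ℕ) := by
  have hc : (hilbertPolynomial ℳ).coeff (m - 1) ≠ 0 := by
    intro h0
    have h1 := multiplicity_eq_factorial_mul_coeff hm h
    rw [h0, mul_zero] at h1
    exact (isHilbertNumerator_hilbertNumerator h).2 (by exact_mod_cast h1)
  refine Polynomial.degree_eq_of_le_of_coeff_ne_zero ?_ hc
  rw [← Polynomial.natDegree_le_iff_degree_le]
  obtain ⟨d, rfl⟩ := Nat.exists_eq_add_of_le' hm
  rw [hilbertPolynomial_eq h]
  exact natDegree_hilbertPoly_le _ _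

theorem isHilbertCoeffs_hilbertCoeff {m : ℕ} (hm : 1 ≤ m) (h : ∃ p, IsHilbertNumerator ℳ m p) :
    IsHilbertCoeffs ℳ m (hilbertCoeff ℳ m) := by
  have hex : ∃ e, IsHilbertCoeffs ℳ m e := by
    obtain ⟨c, hc⟩ := exists_smul_preHilbertPoly m (hilbertPolynomial ℳ) (by
      rw [degree_hilbertPolynomial hm h]
      exact_mod_cast Nat.sub_lt hm one_pos)
    refine ⟨fun k => if k < m then (-1) ^ k * c k else 0, ?_, fun k hk => if_neg (not_lt.mpr hk)⟩
    rw [hc]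
    refine Finset.sum_congr rfl fun k hk => ?_
    simp only [if_pos (Finset.mem_range.mp hk)]
    rw [← mul_assoc, ← mul_pow]
    simp
  rw [hilbertCoeff, dif_pos hex]
  exact hex.choose_spec

theorem multiplicity_eq_hilbertCoeff {m : ℕ} (hm : 1 ≤ m) (h : ∃ p, IsHilbertNumerator ℳ m p) :
    (multiplicity ℳ m : ℚ) = hilbertCoeff ℳ m 0 := by
  obtain ⟨d, rfl⟩ := Nat.exists_eq_add_of_le' hm
  have hf : (d.factorial : ℚ) ≠ 0 := by exact_mod_cast d.factorial_ne_zero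
  rw [multiplicity_eq_factorial_mul_coeff hm h, (isHilbertCoeffs_hilbertCoeff hm h).1,
    -- Only the binomial with `k = 0` reaches degree `m - 1`.
    Polynomial.finsetSum_coeff, Finset.sum_eq_single 0]
  · simp only [Nat.add_sub_cancel, Nat.sub_zero, pow_zero, one_mul, Polynomial.coeff_smul,
      Polynomial.coeff_preHilbertPoly_self, smul_eq_mul]
    field_simp
  · intro k hk hk0
    rw [Finset.mem_range] at hk
    rw [Polynomial.coeff_smul, Polynomial.coeff_eq_zero_of_natDegree_lt, smul_zero]
    rw [Polynomial.natDegree_preHilbertPoly]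
    omega
  · simp

end HilbertPolynomial

/-! ### Finiteness and the numerator, combining growth with rationality -/

section Existence

variable {K S M : Type*} [Field K] [CommRing S] [Algebra K S] [AddCommGroup M] [Module K M]
  [Module S M] [IsScalarTower K S M]

theorem finite_and_exists_isHilbertNumerator (𝒜 : ℕ → Submodule K S) [GradedAlgebra 𝒜]
    (h𝒜 : IsStandardGraded 𝒜) (ℳ : ℕ → Submodule K M) [DirectSum.Decomposition ℳ]
    [SetLike.GradedSMul 𝒜 ℳ] [Module.Finite S M] (m : ℕ) (hm : 1 ≤ m)
    (hdim : Module.supportDim S M = (m : WithBot ℕ∞)) :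
    (∀ n, Module.Finite K (ℳ n)) ∧ ∃ p, IsHilbertNumerator ℳ m p := by
  have := h𝒜.finiteType
  have : IsNoetherianRing S := Algebra.FiniteType.isNoetherianRing K S
  obtain ⟨G, hG1, hG⟩ := h𝒜.exists_finset
  have hdeg : ∀ g ∈ (G : Set S), ∀ n, ∀ x ∈ ℳ n, g • x ∈ ℳ (n + 1) := by
    intro g hg n x hx
    have := SetLike.GradedSMul.smul_mem (hG1 hg) hx
    rwa [vadd_eq_add, add_comm] at this
  obtain ⟨φ, hφ, r, a, h⟩ := exists_finite_faithful_mvPolynomial (K := K) (S := S) (M := M) m hdim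
  obtain ⟨e, he⟩ := exists_le_box φ a ℳ h hG hdeg
  have hfin : ∀ n, Module.Finite K (ℳ n) := fun n =>
    Submodule.finiteDimensional_of_le (he n n le_rfl)
  refine ⟨hfin, ?_⟩
  obtain ⟨p, hp⟩ := exists_pow_mul_hilbertSeries_eq ℳ hfin hG hdeg
  exact exists_numerator hm hp (exists_pow_le_sum_hilbertFunction ℳ hfin φ a h hφ hG hdeg)
    ⟨e, fun n => (sum_hilbertFunction_le_finrank ℳ (he n)).trans (finrank_box_le φ a _)⟩

end Existence

/-! ### Hurwitz zeta functions and continuation of Dirichlet series with eventually polynomial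
coefficients -/

section Hurwitz

theorem coeff_taylor_of_natDegree_le {R : Type*} [CommRing R] (P : Polynomial R) (r : R)
    {d : ℕ} (h : P.natDegree ≤ d) : (Polynomial.taylor r P).coeff d = P.coeff d := by
  rcases h.eq_or_lt with rfl | h
  · rw [Polynomial.coeff_taylor_natDegree, Polynomial.leadingCoeff]
  · rw [Polynomial.coeff_eq_zero_of_natDegree_lt h, Polynomial.coeff_eq_zero_of_natDegree_lt]
    rwa [Polynomial.natDegree_taylor]

/-- Meromorphic continuation of the Hurwitz zeta function for an arbitrary positive parameter. -/
theorem exists_hurwitz_numerator (k : ℕ) : ∀ w : ℝ, 0 < w → w ≤ k + 1 →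
    ∃ H : ℂ → ℂ, Differentiable ℂ H ∧ H 1 = 1 ∧ ∀ s : ℂ, 1 < s.re →
      HasSum (fun n : ℕ => 1 / ((n : ℂ) + (w : ℂ)) ^ s) (H s / (s - 1)) := by
  induction k with
  | zero =>
    intro w hw hw1
    -- The library function depends on `w` modulo `1`, and its series formula needs a representative
    -- in `[0, 1]`. Multiplication by `s - 1` removes the pole, with value the residue `1`.
    let f : ℂ → ℂ := fun s => (s - 1) * HurwitzZeta.hurwitzZeta (w : UnitAddCircle) s
    have hf : ∀ s, s ≠ 1 → DifferentiableAt ℂ f s := fun s hs =>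
      (differentiableAt_id.sub_const 1).mul (HurwitzZeta.differentiableAt_hurwitzZeta _ hs)
    have hupd : ∀ s, s ≠ 1 → Function.update f 1 1 =ᶠ[𝓝 s] f := by
      intro s hs
      filter_upwards [isOpen_ne.mem_nhds hs] with t ht
      exact Function.update_of_ne ht _ _
    refine ⟨Function.update f 1 1, fun s => ?_, Function.update_self _ _ _, fun s hs => ?_⟩
    · by_cases h1 : s = 1
      · subst h1
        refine (Complex.analyticAt_of_differentiable_on_punctured_nhds_of_continuousAt ?_
          ?_).differentiableAt
        · filter_upwards [self_mem_nhdsWithin] with t ht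
          exact (hf t ht).congr_of_eventuallyEq (hupd t ht)
        · rw [continuousAt_update_same]
          exact HurwitzZeta.hurwitzZeta_residue_one _
      · exact (hf s h1).congr_of_eventuallyEq (hupd s h1)
    · have h1 : s ≠ 1 := by
        rintro rfl
        simp at hs
      rw [Function.update_of_ne h1]
      simp only [f]
      rw [mul_div_cancel_left₀ _ (sub_ne_zero.mpr h1)]
      exact HurwitzZeta.hasSum_hurwitzZeta_of_one_lt_re ⟨hw.le, by simpa using hw1⟩ hs
  | succ k ih =>
    intro w hw hwk
    by_cases hw1 : w ≤ k + 1
    · exact ih w hw hw1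
    have hw0 : 0 < w - 1 := by
      have : (0 : ℝ) ≤ k := Nat.cast_nonneg k
      linarith
    obtain ⟨H, hH, hH1, hsum⟩ := ih (w - 1) hw0 (by push_cast at hwk; linarith)
    have hwc : ((w - 1 : ℝ) : ℂ) ≠ 0 := by exact_mod_cast hw0.ne'
    -- This is `ζ(s, w) = ζ(s, w - 1) - (w - 1) ^ (-s)`: the first term of the series is dropped.
    refine ⟨fun s => H s - (s - 1) * ((w - 1 : ℝ) : ℂ) ^ (-s), ?_, by simp [hH1], fun s hs => ?_⟩
    · refine hH.sub ((differentiable_id.sub_const 1).mul ?_)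
      exact fun s => (differentiableAt_id.neg).const_cpow (Or.inl hwc)
    · have h1 : s - 1 ≠ 0 := by
        rw [sub_ne_zero]
        rintro rfl
        simp at hs
      have := (hasSum_nat_add_iff' 1).mpr (hsum s hs)
      convert! this using 1
      · ext n
        congr 2
        push_cast
        ring
      · rw [sub_div, mul_div_cancel_left₀ _ h1, Complex.cpow_neg]
        simp

/-- The data of a meromorphic continuation of `∑ u n / (n + w) ^ z`, when `u` is eventually a
polynomial of degree less than `m`. -/
theorem exists_continuation {u : ℕ → ℂ} {P : Polynomial ℂ} {m : ℕ} (hm : 1 ≤ m)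
    (hP : P.natDegree < m) (hu : ∀ᶠ n : ℕ in atTop, u n = P.eval (n : ℂ)) {w : ℝ} (hw : 0 < w) :
    ∃ F : ℂ → ℂ, MeromorphicOn F Set.univ ∧
      (∀ z : ℂ, (m : ℝ) < z.re → AnalyticAt ℂ F z ∧
        HasSum (fun n : ℕ => u n / ((n : ℂ) + (w : ℂ)) ^ z) (F z)) ∧
      Tendsto (fun z => (z - m) * F z) (𝓝[≠] (m : ℂ)) (𝓝 (P.coeff (m - 1))) := by
  obtain ⟨H, hH, hH1, hsum⟩ := exists_hurwitz_numerator ⌈w⌉₊ w hw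
    ((Nat.le_ceil w).trans (by linarith))
  obtain ⟨N, hN⟩ := eventually_atTop.mp hu
  have hne : ∀ n : ℕ, (n : ℂ) + (w : ℂ) ≠ 0 := by
    intro n
    have : (0 : ℝ) < n + w := by positivity
    exact_mod_cast this.ne'
  -- Expanding in powers of `n + w` turns the `j`-th power into a Hurwitz series at `z - j`.
  let Q := Polynomial.taylor (-(w : ℂ)) P
  have hQ : ∀ n : ℕ, P.eval (n : ℂ) = ∑ j ∈ Finset.range m, Q.coeff j * ((n : ℂ) + w) ^ j := by
    intro n
    rw [← Polynomial.eval_eq_sum_range' (by rwa [Polynomial.natDegree_taylor])]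
    simp [Q, Polynomial.taylor_eval]
  let F₁ : ℂ → ℂ := fun z => ∑ j ∈ Finset.range m, Q.coeff j * (H (z - j) / (z - j - 1))
  -- An entire correction for the finitely many `n` where `u n` may differ from the polynomial.
  let F₂ : ℂ → ℂ := fun z => ∑ n ∈ Finset.range N,
    (u n - P.eval (n : ℂ)) * ((n : ℂ) + (w : ℂ)) ^ (-z)
  have hF₂ : Differentiable ℂ F₂ := by
    refine Differentiable.fun_sum fun n _ => (differentiable_const _).mul fun z => ?_
    exact (differentiableAt_id.neg).const_cpow (Or.inl (hne n))
  have hHj : ∀ j : ℕ, Differentiable ℂ fun z => H (z - j) := fun j =>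
    hH.comp (differentiable_id.sub_const _)
  refine ⟨fun z => F₁ z + F₂ z, ?_, fun z hz => ⟨?_, ?_⟩, ?_⟩
  · intro z _
    refine MeromorphicAt.fun_add (MeromorphicAt.fun_sum fun j _ => ?_)
      (hF₂.analyticAt z).meromorphicAt
    refine (MeromorphicAt.const _ _).mul (MeromorphicAt.fun_div ((hHj j).analyticAt z).meromorphicAt ?_)
    exact AnalyticAt.meromorphicAt (by fun_prop)
  · refine AnalyticAt.add ?_ (hF₂.analyticAt z)
    refine Finset.analyticAt_fun_sum _ fun j hj => ?_
    refine analyticAt_const.mul (((hHj j).analyticAt z).div (by fun_prop) ?_)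
    intro h0
    have h1 := congrArg Complex.re h0
    simp only [Complex.sub_re, Complex.natCast_re, Complex.one_re, Complex.zero_re] at h1
    have h2 : (j : ℝ) + 1 ≤ m := by exact_mod_cast Finset.mem_range.mp hj
    linarith
  · have h1 : HasSum (fun n : ℕ => P.eval (n : ℂ) / ((n : ℂ) + (w : ℂ)) ^ z) (F₁ z) := by
      have : ∀ j ∈ Finset.range m, HasSum (fun n : ℕ => Q.coeff j *
          (1 / ((n : ℂ) + (w : ℂ)) ^ (z - j))) (Q.coeff j * (H (z - j) / (z - j - 1))) := by
        intro j hj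
        refine (hsum (z - j) ?_).mul_left _
        have h2 : (j : ℝ) + 1 ≤ m := by exact_mod_cast Finset.mem_range.mp hj
        simp only [Complex.sub_re, Complex.natCast_re]
        linarith
      convert! hasSum_sum this using 1
      ext n
      rw [hQ, Finset.sum_div]
      refine Finset.sum_congr rfl fun j _ => ?_
      rw [Complex.cpow_sub _ _ (hne n), Complex.cpow_natCast, one_div_div, mul_div_assoc]
    have h2 : HasSum (fun n : ℕ => (u n - P.eval (n : ℂ)) * ((n : ℂ) + (w : ℂ)) ^ (-z)) (F₂ z) := by
      refine hasSum_sum_of_ne_finset_zero fun n hn => ?_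
      rw [Finset.mem_range, not_lt] at hn
      rw [hN n hn, sub_self, zero_mul]
    convert! h1.add h2 using 1
    ext n
    rw [Complex.cpow_neg]
    ring
  · have hlast : Q.coeff (m - 1) = P.coeff (m - 1) := coeff_taylor_of_natDegree_le _ _ (by omega)
    have hterm : ∀ j ∈ Finset.range m, Tendsto
        (fun z : ℂ => (z - m) * (Q.coeff j * (H (z - j) / (z - j - 1)))) (𝓝[≠] (m : ℂ))
        (𝓝 (if j = m - 1 then P.coeff (m - 1) else 0)) := by
      intro j hj
      have hjm := Finset.mem_range.mp hj
      -- The denominator `z - j - 1` vanishes at `z = m` only for `j = m - 1`.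
      by_cases h : j = m - 1
      · rw [if_pos h, ← hlast, ← h]
        have hmj : (m : ℂ) = j + 1 := by
          have : m = j + 1 := by omega
          exact_mod_cast this
        have h1 : Tendsto (fun z : ℂ => Q.coeff j * H (z - j)) (𝓝[≠] (m : ℂ))
            (𝓝 (Q.coeff j)) := by
          have h2 : Tendsto (fun z : ℂ => Q.coeff j * H (z - j)) (𝓝 (m : ℂ))
              (𝓝 (Q.coeff j * H (m - j))) :=
            (((hHj j).continuous).const_mul (Q.coeff j)).tendsto _
          rw [hmj, add_sub_cancel_left, hH1, mul_one, ← hmj] at h2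
          exact h2.mono_left nhdsWithin_le_nhds
        refine h1.congr' ?_
        filter_upwards [self_mem_nhdsWithin] with z hz
        have hz' : z - m ≠ 0 := sub_ne_zero.mpr hz
        rw [sub_sub, ← hmj]
        field_simp
      · rw [if_neg h]
        have hd : (m : ℂ) - j - 1 ≠ 0 := by
          have : (m : ℂ) ≠ j + 1 := by
            have : m ≠ j + 1 := by omega
            exact_mod_cast this
          rw [sub_sub]
          exact sub_ne_zero.mpr this
        have hc : ContinuousAt (fun z : ℂ => (z - m) * (Q.coeff j * (H (z - j) / (z - j - 1))))
            (m : ℂ) := by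
          refine (continuousAt_id.sub continuousAt_const).mul (continuousAt_const.mul
            (((hHj j).continuous.continuousAt).div ?_ hd))
          fun_prop
        have := hc.tendsto
        rw [sub_self, zero_mul] at this
        exact this.mono_left nhdsWithin_le_nhds
    have h1 := tendsto_finsetSum _ hterm
    have h2 : Tendsto (fun z : ℂ => (z - m) * F₂ z) (𝓝[≠] (m : ℂ)) (𝓝 0) := by
      have hc : Continuous fun z : ℂ => (z - m) * F₂ z :=
        (continuous_id.sub continuous_const).mul hF₂.continuous
      have := hc.tendsto (m : ℂ)
      rw [sub_self, zero_mul] at this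
      exact this.mono_left nhdsWithin_le_nhds
    have h3 := h1.add h2
    rw [Finset.sum_ite_eq' , if_pos (Finset.mem_range.mpr (by omega)), add_zero] at h3
    refine h3.congr fun z => ?_
    rw [mul_add, ← Finset.mul_sum]

end Hurwitz

/-! ### Residues and uniqueness of the continuation near the pole -/

section Residue

/-- Filling in the value `R` makes `(z - c) * f z` analytic at `c`. Cauchy's formula then shows that
the normalized integrals over all small circles equal `R`. -/
theorem residue_eq_of_tendsto {f : ℂ → ℂ} {c R : ℂ} (hf : MeromorphicAt f c)
    (h : Tendsto (fun z => (z - c) * f z) (𝓝[≠] c) (𝓝 R)) : residue f c = R := by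
  let g : ℂ → ℂ := Function.update (fun z => (z - c) * f z) c R
  have hgf : ∀ z, z ≠ c → g z = (z - c) * f z := fun z hz => Function.update_of_ne hz _ _
  have hgm : MeromorphicAt g c := by
    have h1 : MeromorphicAt (fun z => (z - c) * f z) c :=
      MeromorphicAt.fun_mul (AnalyticAt.meromorphicAt (by fun_prop)) hf
    refine h1.congr ?_
    filter_upwards [self_mem_nhdsWithin] with z hz
    exact (hgf z hz).symm
  have hgc : ContinuousAt g c := continuousAt_update_same.mpr h
  obtain ⟨ρ, hρ, hball⟩ := Metric.eventually_nhds_iff_ball.mp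
    (hgm.analyticAt hgc).eventually_analyticAt
  refine Tendsto.limUnder_eq (tendsto_const_nhds.congr' ?_)
  filter_upwards [Ioo_mem_nhdsGT hρ] with r hr
  have hd : DifferentiableOn ℂ g (Metric.closedBall c r) := fun z hz =>
    (hball z (Metric.closedBall_subset_ball hr.2 hz)).differentiableAt.differentiableWithinAt
  have h1 := hd.circleIntegral_sub_inv_smul (Metric.mem_ball_self hr.1)
  have h2 : (∮ z in C(c, r), f z) = ∮ z in C(c, r), (z - c)⁻¹ • g z := by
    refine circleIntegral.integral_congr hr.1.le fun z hz => ?_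
    have hzc : z ≠ c := by
      rintro rfl
      have := hr.1
      simp at hz
      linarith
    change f z = (z - c)⁻¹ • g z
    rw [hgf z hzc, smul_eq_mul, inv_mul_cancel_left₀ (sub_ne_zero.mpr hzc)]
  have hgR : g c = R := Function.update_self _ _ _
  rw [h2, h1, hgR, smul_eq_mul, inv_mul_cancel_left₀ Complex.two_pi_I_ne_zero]

/-- Passing to normal form does not change values where `F` is already analytic, so the series
formula survives on the half-plane. -/
theorem exists_isMeromorphicContinuation {v : ℕ → ℂ → ℂ} {σ : ℝ} {F : ℂ → ℂ}
    (hF : MeromorphicOn F Set.univ)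
    (hv : ∀ z : ℂ, σ < z.re → AnalyticAt ℂ F z ∧ HasSum (fun n => v n z) (F z)) :
    IsMeromorphicContinuation v σ (meromorphicContinuation v σ) := by
  have hex : ∃ F, IsMeromorphicContinuation v σ F := by
    refine ⟨toMeromorphicNFOn F Set.univ, meromorphicNFOn_toMeromorphicNFOn F _, fun z hz => ?_⟩
    rw [toMeromorphicNFOn_eq_toMeromorphicNFAt hF (Set.mem_univ z),
      toMeromorphicNFAt_eq_self.mpr (hv z hz).1.meromorphicNFAt]
    exact (hv z hz).2
  rw [meromorphicContinuation, dif_pos hex]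
  exact hex.choose_spec

/-- Near `c`, the meromorphic function `G - F` is either identically zero or nowhere zero on a
punctured neighbourhood. Since `c` lies on the boundary of the half-plane where both equal the
series, the points `c + t` with `t > 0` exclude the second case, and no global identity theorem is
needed. -/
theorem IsMeromorphicContinuation.residue_eq {v : ℕ → ℂ → ℂ} {c : ℝ} {F G : ℂ → ℂ} {R : ℂ}
    (hG : IsMeromorphicContinuation v c G) (hF : MeromorphicOn F Set.univ)
    (hv : ∀ z : ℂ, c < z.re → HasSum (fun n => v n z) (F z))
    (hR : Tendsto (fun z => (z - c) * F z) (𝓝[≠] (c : ℂ)) (𝓝 R)) : residue G c = R := by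
  have hGc : MeromorphicAt G c := (hG.meromorphic (Set.mem_univ _)).meromorphicAt
  have heq : ∀ᶠ z in 𝓝[≠] (c : ℂ), G z - F z = 0 := by
    refine ((MeromorphicAt.fun_sub hGc (hF c trivial)).eventually_eq_zero_or_eventually_ne_zero
      ).resolve_right fun hne => ?_
    have ht : Tendsto (fun t : ℝ => (c : ℂ) + t) (𝓝[>] 0) (𝓝[≠] (c : ℂ)) := by
      refine tendsto_nhdsWithin_iff.mpr ⟨?_, ?_⟩
      · have hc : Continuous fun t : ℝ => (c : ℂ) + t := by fun_prop
        have := hc.tendsto 0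
        simp only [Complex.ofReal_zero, add_zero] at this
        exact this.mono_left nhdsWithin_le_nhds
      · filter_upwards [self_mem_nhdsWithin] with t ht
        have : (t : ℂ) ≠ 0 := by exact_mod_cast (ne_of_gt ht : t ≠ 0)
        simpa using this
    obtain ⟨t, ht1, ht2⟩ := ((ht.eventually hne).and self_mem_nhdsWithin).exists
    have ht2 : 0 < t := ht2
    have hre : c < ((c : ℂ) + t).re := by simpa using ht2
    exact ht1 (sub_eq_zero.mpr ((hG.hasSum _ hre).unique (hv _ hre)))
  refine residue_eq_of_tendsto hGc (hR.congr' ?_)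
  filter_upwards [heq] with z hz
  rw [sub_eq_zero.mp hz]

end Residue

/-! ### The zeta functions of the module -/

section Zeta

variable {K M : Type*} [Field K] [AddCommGroup M] [Module K M] {ℳ : ℕ → Submodule K M}
  {P : Polynomial ℚ} {m : ℕ}

theorem IsHilbertPolynomial.eventually_map (hP : IsHilbertPolynomial ℳ P) :
    ∀ᶠ n : ℕ in atTop, (hilbertFunction ℳ n : ℂ) =
      (P.map (algebraMap ℚ ℂ)).eval (n : ℂ) := by
  filter_upwards [hP] with n hn
  have h1 := congrArg (algebraMap ℚ ℂ) hn
  rw [map_natCast] at h1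
  rw [← h1, ← Polynomial.eval_map_apply, map_natCast]

theorem zetaBarnes_spec (hm : 1 ≤ m) (hP : IsHilbertPolynomial ℳ P) (hdeg : P.natDegree < m)
    {w : ℝ} (hw : 0 < w) :
    IsMeromorphicContinuation (zetaBarnesTerm ℳ w) m (zetaBarnes ℳ m w) ∧
      residue (zetaBarnes ℳ m w) m = (P.coeff (m - 1) : ℂ) := by
  obtain ⟨F, hF, hsum, hres⟩ := exists_continuation hm
    ((Polynomial.natDegree_map_le (f := algebraMap ℚ ℂ)).trans_lt hdeg) hP.eventually_map hw
  have h1 : IsMeromorphicContinuation (zetaBarnesTerm ℳ w) m (zetaBarnes ℳ m w) :=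
    exists_isMeromorphicContinuation hF hsum
  refine ⟨h1, ?_⟩
  have := h1.residue_eq hF (fun z hz => (hsum z hz).2)
    (R := (P.coeff (m - 1) : ℂ)) (by simpa using hres)
  simpa using this

theorem zeta_spec (hm : 1 ≤ m) (hP : IsHilbertPolynomial ℳ P) (hdeg : P.natDegree < m) :
    IsMeromorphicContinuation (zetaTerm ℳ) m (zeta ℳ m) ∧
      residue (zeta ℳ m) m = (P.coeff (m - 1) : ℂ) := by
  -- With the index shifted by one, the series is the case `w = 1` with coefficients eventually `P(n
  -- + 1)`.
  let P' := Polynomial.taylor 1 (P.map (algebraMap ℚ ℂ))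
  have hPd : (P.map (algebraMap ℚ ℂ)).natDegree < m := Polynomial.natDegree_map_le.trans_lt hdeg
  have hP' : P'.natDegree < m := by rwa [Polynomial.natDegree_taylor]
  have hcoeff : P'.coeff (m - 1) = (P.coeff (m - 1) : ℂ) := by
    rw [coeff_taylor_of_natDegree_le _ _ (by omega), Polynomial.coeff_map]
    rfl
  have hu : ∀ᶠ n : ℕ in atTop, (hilbertFunction ℳ (n + 1) : ℂ) = P'.eval (n : ℂ) := by
    filter_upwards [(tendsto_add_atTop_nat 1).eventually hP.eventually_map] with n hn
    rw [hn, Polynomial.taylor_eval]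
    push_cast
    rw [add_comm]
  obtain ⟨F, hF, hsum, hres⟩ := exists_continuation hm hP' hu one_pos
  have hterm : ∀ n z, (hilbertFunction ℳ (n + 1) : ℂ) / ((n : ℂ) + ((1 : ℝ) : ℂ)) ^ z =
      zetaTerm ℳ n z := by
    intro n z
    simp [zetaTerm]
  simp_rw [hterm] at hsum
  have h1 : IsMeromorphicContinuation (zetaTerm ℳ) m (zeta ℳ m) :=
    exists_isMeromorphicContinuation hF hsum
  refine ⟨h1, ?_⟩
  have := h1.residue_eq hF (fun z hz => (hsum z hz).2)
    (R := (P.coeff (m - 1) : ℂ)) (by rw [← hcoeff]; simpa using hres)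
  simpa using this

/-- The subtracted quantity is exactly the term `n = 0`. As `Re z ≥ 0`, each remaining term is
dominated by its value at `w = 0`, so dominated convergence applies. -/
theorem tendsto_zetaBarnes_sub
    (hB : ∀ w : ℝ, 0 < w → IsMeromorphicContinuation (zetaBarnesTerm ℳ w) m (zetaBarnes ℳ m w))
    (hZ : IsMeromorphicContinuation (zetaTerm ℳ) m (zeta ℳ m)) {z : ℂ} (hz : (m : ℝ) < z.re) :
    Tendsto (fun w : ℝ => zetaBarnes ℳ m w z - (hilbertFunction ℳ 0 : ℂ) * (w : ℂ) ^ (-z))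
      (𝓝[>] 0) (𝓝 (zeta ℳ m z)) := by
  have hZs := hZ.hasSum z hz
  have h1 : ∀ᶠ w : ℝ in 𝓝[>] 0, ∑' n, zetaBarnesTerm ℳ w (n + 1) z =
      zetaBarnes ℳ m w z - (hilbertFunction ℳ 0 : ℂ) * (w : ℂ) ^ (-z) := by
    filter_upwards [self_mem_nhdsWithin] with w hw
    have := ((hasSum_nat_add_iff' 1).mpr ((hB w hw).hasSum z hz)).tsum_eq
    rw [this]
    simp [zetaBarnesTerm, Complex.cpow_neg, div_eq_mul_inv]
  rw [← hZs.tsum_eq]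
  refine Tendsto.congr' h1 ?_
  refine tendsto_tsum_of_dominated_convergence (bound := fun n => ‖zetaTerm ℳ n z‖)
    hZs.summable.norm (fun n => ?_) ?_
  · have hpos : ((n + 1 : ℕ) : ℂ) ∈ Complex.slitPlane := Complex.natCast_mem_slitPlane.mpr (by omega)
    have hc : ContinuousAt (fun w : ℝ => zetaBarnesTerm ℳ w (n + 1) z) 0 := by
      unfold zetaBarnesTerm
      refine continuousAt_const.div ?_ ?_
      · refine ContinuousAt.cpow (by fun_prop) continuousAt_const ?_
        simpa using hpos
      · rw [Complex.ofReal_zero, add_zero]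
        exact fun h0 => Complex.slitPlane_ne_zero hpos ((Complex.cpow_eq_zero_iff _ _).mp h0).1
    have := hc.tendsto.mono_left (nhdsWithin_le_nhds (s := Set.Ioi 0))
    simpa [zetaBarnesTerm, zetaTerm] using this
  · filter_upwards [self_mem_nhdsWithin] with w hw n
    have hw : 0 < w := hw
    have hn : (0 : ℝ) < ((n + 1 : ℕ) : ℝ) := by positivity
    have hre : 0 ≤ z.re := (Nat.cast_nonneg m).trans hz.le
    rw [zetaBarnesTerm, zetaTerm, norm_div, norm_div]
    have h2 : (((n + 1 : ℕ) : ℂ) + (w : ℂ)) = (((n + 1 : ℕ) + w : ℝ) : ℂ) := by push_cast; ring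
    have h3 : ((n + 1 : ℕ) : ℂ) = (((n + 1 : ℕ) : ℝ) : ℂ) := by push_cast; ring
    rw [h2, h3, Complex.norm_cpow_eq_rpow_re_of_pos (by positivity),
      Complex.norm_cpow_eq_rpow_re_of_pos hn]
    have h4 : ((n + 1 : ℕ) : ℝ) ≤ (n + 1 : ℕ) + w := by linarith
    have h5 : 0 < ((n + 1 : ℕ) : ℝ) ^ z.re := Real.rpow_pos_of_pos hn _
    gcongr

end Zeta

end GradedZeta

end

/-- The first eight conjuncts say that the objects in the formulas are the genuine ones (finite
dimensions, numerator of the Hilbert series, Hilbert polynomial of degree `m - 1`, binomial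
coefficients, meromorphic continuations, and `ζ_M(z)` as a limit of `ζ_M(z, w) - H(M, 0) w ^ (-z)`);
the remaining ones are the formulas for the multiplicity. -/
theorem corollary3p3 {K S M : Type*} [Field K] [CommRing S] [Algebra K S]
    (𝒜 : ℕ → Submodule K S) [GradedAlgebra 𝒜] (h𝒜 : GradedZeta.IsStandardGraded 𝒜)
    [AddCommGroup M] [Module K M] [Module S M] [IsScalarTower K S M]
    (ℳ : ℕ → Submodule K M) [DirectSum.Decomposition ℳ] [SetLike.GradedSMul 𝒜 ℳ]
    [Module.Finite S M]
    (m : ℕ) (hm : 1 ≤ m) (hdim : Module.supportDim S M = (m : WithBot ℕ∞)) :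
    (∀ n, Module.Finite K (ℳ n)) ∧
    GradedZeta.IsHilbertNumerator ℳ m (GradedZeta.hilbertNumerator ℳ m) ∧
    GradedZeta.IsHilbertPolynomial ℳ (GradedZeta.hilbertPolynomial ℳ) ∧
    (GradedZeta.hilbertPolynomial ℳ).degree = ((m - 1 : ℕ) : WithBot ℕ) ∧
    GradedZeta.IsHilbertCoeffs ℳ m (GradedZeta.hilbertCoeff ℳ m) ∧
    (∀ w : ℝ, 0 < w → GradedZeta.IsMeromorphicContinuation
      (GradedZeta.zetaBarnesTerm ℳ w) m (GradedZeta.zetaBarnes ℳ m w)) ∧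
    GradedZeta.IsMeromorphicContinuation (GradedZeta.zetaTerm ℳ) m (GradedZeta.zeta ℳ m) ∧
    (∀ z : ℂ, (m : ℝ) < z.re → Tendsto
      (fun w : ℝ => GradedZeta.zetaBarnes ℳ m w z
        - (GradedZeta.hilbertFunction ℳ 0 : ℂ) * (w : ℂ) ^ (-z))
      (𝓝[>] 0) (𝓝 (GradedZeta.zeta ℳ m z))) ∧
    (GradedZeta.multiplicity ℳ m : ℚ) = GradedZeta.hilbertCoeff ℳ m 0 ∧
    (GradedZeta.multiplicity ℳ m : ℚ) =
      ((m - 1).factorial : ℚ) * (GradedZeta.hilbertPolynomial ℳ).coeff (m - 1) ∧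
    (GradedZeta.multiplicity ℳ m : ℂ) =
      ((m - 1).factorial : ℂ) * GradedZeta.residue (GradedZeta.zeta ℳ m) m ∧
    Tendsto (fun w : ℝ => GradedZeta.residue (GradedZeta.zetaBarnes ℳ m w) m)
      (𝓝[>] 0) (𝓝 (GradedZeta.residue (GradedZeta.zeta ℳ m) m)) ∧
    Tendsto
      (fun w : ℝ => ((m - 1).factorial : ℂ) * GradedZeta.residue (GradedZeta.zetaBarnes ℳ m w) m)
      (𝓝[>] 0) (𝓝 (GradedZeta.multiplicity ℳ m : ℂ)) := by
  obtain ⟨hfin, hnum⟩ := GradedZeta.finite_and_exists_isHilbertNumerator 𝒜 h𝒜 ℳ m hm hdim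
  have hP := GradedZeta.isHilbertPolynomial_hilbertPolynomial hnum
  have hdeg := GradedZeta.degree_hilbertPolynomial hm hnum
  have hnat : (GradedZeta.hilbertPolynomial ℳ).natDegree < m := by
    rw [Polynomial.natDegree_eq_of_degree_eq_some hdeg]
    omega
  have hB := fun (w : ℝ) (hw : 0 < w) => GradedZeta.zetaBarnes_spec hm hP hnat hw
  obtain ⟨hZ, hZres⟩ := GradedZeta.zeta_spec hm hP hnat
  have hmul := GradedZeta.multiplicity_eq_factorial_mul_coeff hm hnum
  have hmulC : (GradedZeta.multiplicity ℳ m : ℂ) =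
      ((m - 1).factorial : ℂ) * GradedZeta.residue (GradedZeta.zeta ℳ m) m := by
    rw [hZres]
    exact_mod_cast congrArg (Rat.cast : ℚ → ℂ) hmul
  have hlim : Tendsto (fun w : ℝ => GradedZeta.residue (GradedZeta.zetaBarnes ℳ m w) m)
      (𝓝[>] 0) (𝓝 (GradedZeta.residue (GradedZeta.zeta ℳ m) m)) := by
    -- Both residues are the same coefficient of the Hilbert polynomial, so the function is constant
    -- for `w > 0`.
    refine tendsto_const_nhds.congr' ?_
    filter_upwards [self_mem_nhdsWithin] with w hw
    rw [hZres, (hB w hw).2]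
  refine ⟨hfin, GradedZeta.isHilbertNumerator_hilbertNumerator hnum, hP, hdeg,
    GradedZeta.isHilbertCoeffs_hilbertCoeff hm hnum, fun w hw => (hB w hw).1, hZ,
    fun z hz => GradedZeta.tendsto_zetaBarnes_sub (fun w hw => (hB w hw).1) hZ hz,
    GradedZeta.multiplicity_eq_hilbertCoeff hm hnum, hmul, hmulC, hlim, ?_⟩
  rw [hmulC]
  exact hlim.const_mul _
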